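/- Consider a $K$-tier downlink cellular network, $K\ge 1$, with path-loss exponent $\eta=4$, no noise, and a test user at the origin of $\mathbb R^2$. The base stations (BSs) of tier $i\in\{1,\dots,K\}$ form a homogeneous Poisson point process $\{x_{i,n}\}_{n}$ of intensity $\lambda_i>0$; the tiers are mutually independent. All BSs of tier $i$ transmit with power $P_i>0$ and have bias factor $B_i>0$. The fading coefficients $h_{i,n}$ are i.i.d. circularly symmetric complex Gaussian $\mathcal{CN}(0,1)$ (Rayleigh fading), independent of all BS locations. Let $r_{0,i}=\min_n\|x_{i,n}\|$. The user associates with tier $k$ (and is then served by the nearest BS of that tier) if $B_kP_kr_{0,k}^{-4}>B_iP_ir_{0,i}^{-4}$ for all $i\ne k$; let $\mathcal A_k$ be the probability of this event. For a user served by tier $k$, let $$\mathcal I^{(k)}=\sum_{(i,n)\,:\,x_{i,n}\text{ not the serving BS}}P_i|h_{i,n}|^2\|x_{i,n}\|^{-4}$$ be the aggregate interference power. For $a\ge 0$ define the spatially averaged Laplace transforms $$\mathcal L^{(k)}(a)=\mathbb E\Big[\exp\Big(-\tfrac{a\,r_{0,k}^4}{P_k}\,\mathcal I^{(k)}\Big)\,\Big|\,\text{the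 user associates with tier }k\Big],\qquad \mathcal L(a)=\sum_{k=1}^K\mathcal A_k\,\mathcal L^{(k)}(a).$$ Then $\mathcal I^{(k)}<\infty$ almost surely for every $k$, and for all $k$ and all $a\ge0$: $$\mathcal A_k=\frac{\lambda_k\sqrt{B_kP_k}}{\sum_{i=1}^K\lambda_i\sqrt{B_iP_i}},$$ $$\mathcal L^{(k)}(a)=\frac{\sum_{i=1}^K\sqrt{B_iP_i}\,\lambda_i}{\sum_{l=1}^K\sqrt{B_lP_l}\,\lambda_l\Big(1+\sqrt{\tfrac{aB_k}{B_l}}\arctan\sqrt{\tfrac{aB_k}{B_l}}\Big)},$$ $$\mathcal L(a)=\sum_{k=1}^K\Bigg(\sum_{i=1}^K\frac{\lambda_i}{\lambda_k}\sqrt{\frac{B_iP_i}{B_kP_k}}\Big[1+\sqrt{\tfrac{aB_k}{B_i}}\arctan\sqrt{\tfrac{aB_k}{B_i}}\Big]\Bigg)^{-1}.$$ Without biasing, i.e. if all $B_i$ are equal (in particular if $B_i=1$ for all $i$), $$\mathcal L(a)=\frac{1}{1+\sqrt a\,\arctan\sqrt a},$$ which does not depend on the powers, the intensities or the number of tiers.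 -/

import Mathlib

open MeasureTheory ProbabilityTheory
open scoped NNReal ENNReal

namespace MultiTier

/-- The plane in which the base stations (BSs) are located. The test user sits at the origin. -/
abbrev Plane : Type := EuclideanSpace ℝ (Fin 2)

/-- The number of points of the enumerated point process `X` that fall in the set `A`. -/
noncomputable def count {Ω : Type*} (X : ℕ → Ω → Plane) (A : Set Plane) (ω : Ω) : ℕ∞ :=
  {n : ℕ | X n ω ∈ A}.encard

/-- The random points `X 0, X 1, …` form (an enumeration of) a homogeneous Poisson point process
of intensity `lam` in the plane: the numbers of points in finitely many pairwise disjoint bounded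
Borel sets are independent and Poisson distributed, with means `lam` times the areas. The order of
the enumeration is arbitrary. -/
structure IsPoissonPointProcess {Ω : Type*} [MeasurableSpace Ω] (μ : Measure Ω)
    (lam : ℝ) (X : ℕ → Ω → Plane) : Prop where
  measurable : ∀ n, Measurable (X n)
  count_law : ∀ (m : ℕ) (A : Fin m → Set Plane),
    (∀ j, MeasurableSet (A j)) → (∀ j, Bornology.IsBounded (A j)) →
    Pairwise (fun j l => Disjoint (A j) (A l)) →
    ∀ N : Fin m → ℕ,
      μ {ω | ∀ j, count X (A j) ω = (N j : ℕ∞)} =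
        ∏ j, poissonMeasure (Real.toNNReal (lam * (volume (A j)).toReal)) {N j}

/-- The law `𝒞𝒩(0,1)` of a circularly symmetric complex Gaussian of unit variance: real and
imaginary parts are independent centred Gaussians of variance `1 / 2`. -/
noncomputable def stdComplexGaussian : Measure ℂ :=
  ((gaussianReal 0 (1 / 2)).prod (gaussianReal 0 (1 / 2))).map Complex.measurableEquivRealProd.symm

/-- A `K`-tier downlink network: the BSs of tier `i` are located at `X i 0, X i 1, …`, and the
link from the BS at `X i n` to the test user has the complex (amplitude) fading coefficient
`h i n`. The tiers are independent Poisson point processes of intensities `lam i`, and the fading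
coefficients are i.i.d. `𝒞𝒩(0,1)` (Rayleigh fading), independent of all locations. -/
structure IsNetwork {Ω : Type*} [MeasurableSpace Ω] (μ : Measure Ω) {K : ℕ}
    (lam : Fin K → ℝ) (X : Fin K → ℕ → Ω → Plane) (h : Fin K → ℕ → Ω → ℂ) : Prop where
  tier_poisson : ∀ i, IsPoissonPointProcess μ (lam i) (X i)
  tier_indep : iIndepFun (fun (i : Fin K) (ω : Ω) => fun n : ℕ => X i n ω) μ
  fading_measurable : ∀ i n, Measurable (h i n)
  fading_law : ∀ i n, μ.map (h i n) = stdComplexGaussian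
  fading_indep : iIndepFun (fun (p : Fin K × ℕ) (ω : Ω) => h p.1 p.2 ω) μ
  fading_indep_location :
    IndepFun (fun (ω : Ω) (i : Fin K) (n : ℕ) => X i n ω)
      (fun (ω : Ω) (i : Fin K) (n : ℕ) => h i n ω) μ

section Model

variable {Ω : Type*} {K : ℕ}

/-- The distance `r_{0,i}` from the test user to the nearest BS of tier `i`. -/
noncomputable def nearestDist (X : Fin K → ℕ → Ω → Plane) (i : Fin K) (ω : Ω) : ℝ :=
  ⨅ n, ‖X i n ω‖

/-- The event that the test user associates with tier `k` under biased received-signal-strength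
association with powers `P`, bias factors `B` and path-loss exponent `4`:
`B_k P_k r_{0,k}^{-4} > B_i P_i r_{0,i}^{-4}` for all `i ≠ k`. -/
def assocEvent (P B : Fin K → ℝ) (X : Fin K → ℕ → Ω → Plane) (k : Fin K) : Set Ω :=
  {ω | ∀ i, i ≠ k →
    B i * P i / nearestDist X i ω ^ 4 < B k * P k / nearestDist X k ω ^ 4}

open Classical in
/-- The interference power that the BS `p = (i, n)` causes at a test user served by the nearest BS
of tier `k`: `P_i |h_{i,n}|² ‖X_{i,n}‖^{-4}`, and `0` if this BS is the serving one. -/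
noncomputable def interferenceTerm (P : Fin K → ℝ) (X : Fin K → ℕ → Ω → Plane)
    (h : Fin K → ℕ → Ω → ℂ) (k : Fin K) (ω : Ω) (p : Fin K × ℕ) : ℝ :=
  if p.1 = k ∧ ‖X p.1 p.2 ω‖ = nearestDist X k ω then 0
  else P p.1 * ‖h p.1 p.2 ω‖ ^ 2 / ‖X p.1 p.2 ω‖ ^ 4

/-- The aggregate interference, from all BSs of all tiers except the serving one, at a test user
served by the nearest BS of tier `k`. -/
noncomputable def interference (P : Fin K → ℝ) (X : Fin K → ℕ → Ω → Plane)
    (h : Fin K → ℕ → Ω → ℂ) (k : Fin K) (ω : Ω) : ℝ :=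
  ∑' p : Fin K × ℕ, interferenceTerm P X h k ω p

variable [MeasurableSpace Ω]

/-- The tier-association probability `𝒜_k`. -/
noncomputable def assocProb (μ : Measure Ω) (P B : Fin K → ℝ) (X : Fin K → ℕ → Ω → Plane)
    (k : Fin K) : ℝ :=
  μ.real (assocEvent P B X k)

/-- The spatially averaged Laplace transform of the aggregate interference for a user of tier `k`,
evaluated at `z = a r_{0,k}^4 / P_k`: the conditional expectation of `exp (-z I)` given that the
test user associates with tier `k`. -/
noncomputable def tierLT (μ : Measure Ω) (P B : Fin K → ℝ) (X : Fin K → ℕ → Ω → Plane)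
    (h : Fin K → ℕ → Ω → ℂ) (a : ℝ) (k : Fin K) : ℝ :=
  ∫ ω, Real.exp (-(a * nearestDist X k ω ^ 4 / P k * interference P X h k ω))
    ∂(ProbabilityTheory.cond μ (assocEvent P B X k))

/-- The averaged Laplace transform of the aggregate interference, over all tiers. -/
noncomputable def averagedLT (μ : Measure Ω) (P B : Fin K → ℝ) (X : Fin K → ℕ → Ω → Plane)
    (h : Fin K → ℕ → Ω → ℂ) (a : ℝ) : ℝ :=
  ∑ k, assocProb μ P B X k * tierLT μ P B X h a k

end Model

end MultiTier

/-!
By Slivnyak's theorem, a base station of tier `k` at squared distance `s` from the user sees the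
other stations as the original network. In terms of these, being the serving station means that
certain discs around the user, with radii proportional to `√s`, are empty, and Rayleigh fading turns
an interferer of relative strength `w` into the factor `1 / (1 + w)`. Emptiness is the limit of such
a factor, an infinite cost, so both effects together are the exponential of a sum over the stations
of a single cost function, and the Laplace functional of the Poisson process gives its expectation
`exp (-C s)`. The arctangents in `C` come from `∫₁^∞ θ / (θ + u²) du = √θ arctan √θ`. Integrating
over the serving station gives `λ_k π ∫₀^∞ exp (-C s) ds = λ_k π / C`. The case `a = 0` is the
association probability.

The cost function depends on the serving distance. Since this dependence is monotone, it can be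
frozen on thin shells, where the version of Slivnyak's theorem for a fixed cost function suffices.
-/

namespace MultiTier

open Filter Topology

/-- The decreasing exponential `x ↦ exp (-x)` on `[0, ∞]`, with `exp (-∞) = 0`: an infinite cost
encodes a forbidden configuration, so that indicators of events become exponentials of costs. -/
noncomputable def negExp (x : ℝ≥0∞) : ℝ≥0∞ := EReal.exp (-(x : EReal))

@[simp] lemma negExp_zero : negExp 0 = 1 := by simp [negExp]

@[simp] lemma negExp_top : negExp ⊤ = 0 := by simp [negExp]

lemma negExp_ofReal {x : ℝ} (hx : 0 ≤ x) :
    negExp (ENNReal.ofReal x) = ENNReal.ofReal (Real.exp (-x)) := by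
  rw [negExp, EReal.coe_ennreal_ofReal, max_eq_left hx, ← EReal.coe_neg, EReal.exp_coe]

lemma negExp_add (x y : ℝ≥0∞) : negExp (x + y) = negExp x * negExp y := by
  rw [negExp, EReal.coe_ennreal_add, EReal.neg_add (by simp) (by simp), sub_eq_add_neg,
    EReal.exp_add, negExp, negExp]

lemma negExp_antitone : Antitone negExp := fun _ _ hxy ↦
  EReal.exp_monotone (EReal.neg_le_neg_iff.2 (EReal.coe_ennreal_le_coe_ennreal_iff.2 hxy))

lemma negExp_le_one (x : ℝ≥0∞) : negExp x ≤ 1 := by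
  simpa using negExp_antitone (zero_le (a := x))

lemma continuous_negExp : Continuous negExp :=
  ENNReal.continuous_exp.comp (continuous_neg.comp continuous_coe_ennreal_ereal)

@[fun_prop]
lemma measurable_negExp : Measurable negExp := continuous_negExp.measurable

lemma negExp_sum {ι : Type*} (s : Finset ι) (f : ι → ℝ≥0∞) :
    negExp (∑ i ∈ s, f i) = ∏ i ∈ s, negExp (f i) := by
  induction s using Finset.cons_induction with
  | empty => simp
  | cons j s hj ih => rw [Finset.sum_cons, Finset.prod_cons, negExp_add, ih]

lemma negExp_mul_natCast (x : ℝ≥0∞) (n : ℕ) : negExp (x * n) = negExp x ^ n := by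
  simpa [mul_comm] using negExp_sum (Finset.range n) (fun _ ↦ x)

lemma pow_mul_poissonMeasure_singleton (r : ℝ≥0) {t : ℝ≥0} (ht : t ≤ 1) (n : ℕ) :
    (t : ℝ≥0∞) ^ n * poissonMeasure r {n} =
      negExp (r * (1 - t)) * poissonMeasure (r * t) {n} := by
  have hexponent : (r : ℝ≥0∞) * (1 - t) = ENNReal.ofReal (r * (1 - t)) := by
    rw [ENNReal.ofReal_mul (by positivity), ENNReal.ofReal_sub _ (by positivity)]
    simp
  rw [hexponent, negExp_ofReal (mul_nonneg r.coe_nonneg (sub_nonneg.2 (by exact_mod_cast ht))),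
    poissonMeasure_singleton, poissonMeasure_singleton, ← ENNReal.ofReal_coe_nnreal,
    ← ENNReal.ofReal_pow t.coe_nonneg, ← ENNReal.ofReal_mul (by positivity),
    ← ENNReal.ofReal_mul (by positivity)]
  congr 1
  have hexp : Real.exp (-r) = Real.exp (-(r * (1 - t))) * Real.exp (-(r * t)) := by
    rw [← Real.exp_add]; ring_nf
  rw [hexp]
  push_cast
  ring

lemma lintegral_pow_poissonMeasure (r : ℝ≥0) {t : ℝ≥0∞} (ht : t ≤ 1) :
    ∫⁻ n, t ^ n ∂(poissonMeasure r) = negExp (r * (1 - t)) := by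
  lift t to ℝ≥0 using (ht.trans_lt ENNReal.one_lt_top).ne
  simp_rw [lintegral_countable', pow_mul_poissonMeasure_singleton r (by exact_mod_cast ht),
    ENNReal.tsum_mul_left]
  have hmass := lintegral_countable' (μ := poissonMeasure (r * t)) (fun _ ↦ 1)
  simp only [lintegral_const, measure_univ, one_mul] at hmass
  rw [← hmass, mul_one]

-- The size-biased Poisson law is the Poisson law shifted by one.
lemma lintegral_natCast_mul_poissonMeasure (r : ℝ≥0) (f : ℕ → ℝ≥0∞) :
    ∫⁻ n : ℕ, n * f (n - 1) ∂(poissonMeasure r) = r * ∫⁻ n, f n ∂(poissonMeasure r) := by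
  rw [lintegral_countable', lintegral_countable', tsum_eq_zero_add' ENNReal.summable,
    ← ENNReal.tsum_mul_left]
  simp only [Nat.cast_zero, zero_mul, zero_add, Nat.add_sub_cancel]
  refine tsum_congr fun n ↦ ?_
  have hweight : ((n + 1 : ℕ) : ℝ≥0∞) * poissonMeasure r {n + 1} = r * poissonMeasure r {n} := by
    rw [poissonMeasure_singleton, poissonMeasure_singleton, ← ENNReal.ofReal_natCast,
      ← ENNReal.ofReal_coe_nnreal, ← ENNReal.ofReal_mul (by positivity),
      ← ENNReal.ofReal_mul (by positivity), Nat.factorial_succ]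
    congr 1
    push_cast
    field_simp
    ring
  rw [mul_right_comm, hweight]
  ring

lemma tendsto_tsum_of_monotone {ι : Type*} {f : ℕ → ι → ℝ≥0∞} {F : ι → ℝ≥0∞}
    (hf : Monotone f) (hF : ∀ i, Tendsto (fun n ↦ f n i) atTop (𝓝 (F i))) :
    Tendsto (fun n ↦ ∑' i, f n i) atTop (𝓝 (∑' i, F i)) := by
  let _ : MeasurableSpace ι := ⊤
  simp_rw [← lintegral_count]
  exact lintegral_tendsto_of_tendsto_of_monotone (fun n ↦ measurable_from_top.aemeasurable)
    (ae_of_all _ fun i n m hnm ↦ hf hnm i) (ae_of_all _ hF)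

lemma tendsto_tsum_of_dominated {ι : Type*} {f : ℕ → ι → ℝ≥0∞} {F bound : ι → ℝ≥0∞}
    (hle : ∀ n i, f n i ≤ bound i) (hbound : ∑' i, bound i ≠ ⊤)
    (hF : ∀ i, Tendsto (fun n ↦ f n i) atTop (𝓝 (F i))) :
    Tendsto (fun n ↦ ∑' i, f n i) atTop (𝓝 (∑' i, F i)) := by
  let _ : MeasurableSpace ι := ⊤
  simp_rw [← lintegral_count] at hbound ⊢
  exact tendsto_lintegral_of_dominated_convergence bound (fun _ ↦ measurable_from_top)
    (fun n ↦ ae_of_all _ (hle n)) hbound (ae_of_all _ hF)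

section Count

variable {Ω : Type*} [MeasurableSpace Ω] {X : ℕ → Ω → Plane}

lemma toENNReal_count {Ω : Type*} (X : ℕ → Ω → Plane) (A : Set Plane) (ω : Ω) :
    ((count X A ω : ℕ∞) : ℝ≥0∞) = ∑' n, A.indicator (fun _ ↦ 1) (X n ω) := by
  rw [count, ← ENNReal.tsum_set_one, tsum_subtype {n | X n ω ∈ A} (fun _ ↦ (1 : ℝ≥0∞))]
  rfl

lemma measurable_count (hX : ∀ n, Measurable (X n)) {A : Set Plane} (hA : MeasurableSet A) :
    Measurable (count X A) := by
  refine measurable_to_countable' fun N ↦ ?_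
  have hpreimage : count X A ⁻¹' {N} =
      (fun ω ↦ ∑' n, A.indicator (fun _ ↦ (1 : ℝ≥0∞)) (X n ω)) ⁻¹' {(N : ℝ≥0∞)} := by
    ext ω
    simp only [Set.mem_preimage, Set.mem_singleton_iff, ← toENNReal_count]
    exact ENat.toENNReal_inj.symm
  rw [hpreimage]
  exact Measurable.tsum (fun n ↦ (measurable_const.indicator hA).comp (hX n))
    (measurableSet_singleton _)

variable {μ : Measure Ω} {lam : ℝ}

lemma IsPoissonPointProcess.measure_count_eq (hX : IsPoissonPointProcess μ lam X) {A : Set Plane}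
    (hA : MeasurableSet A) (hb : Bornology.IsBounded A) (N : ℕ) :
    μ {ω | count X A ω = N} = poissonMeasure (lam * (volume A).toReal).toNNReal {N} := by
  simpa using hX.count_law 1 (fun _ ↦ A) (fun _ ↦ hA) (fun _ ↦ hb)
    (fun i j hij ↦ absurd (Subsingleton.elim i j) hij) (fun _ ↦ N)

lemma IsPoissonPointProcess.ae_count_ne_top [IsProbabilityMeasure μ]
    (hX : IsPoissonPointProcess μ lam X) {A : Set Plane} (hA : MeasurableSet A)
    (hb : Bornology.IsBounded A) : ∀ᵐ ω ∂μ, count X A ω ≠ ⊤ := by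
  have hmeas : ∀ N : ℕ, MeasurableSet {ω | count X A ω = N} := fun N ↦
    measurable_count hX.measurable hA (measurableSet_singleton (N : ℕ∞))
  have hdisj : Pairwise (Function.onFun Disjoint fun N : ℕ ↦ {ω | count X A ω = N}) :=
    fun N M hNM ↦ Set.disjoint_left.2 fun ω hN hM ↦ hNM (by exact_mod_cast hN.symm.trans hM)
  have hmass : μ (⋃ N : ℕ, {ω | count X A ω = N}) = 1 := by
    simp_rw [measure_iUnion hdisj hmeas, hX.measure_count_eq hA hb]
    simpa using (lintegral_countable'
      (μ := poissonMeasure (lam * (volume A).toReal).toNNReal) (fun _ ↦ 1)).symm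
  have hfinite : ∀ᵐ ω ∂μ, ω ∈ ⋃ N : ℕ, {ω | count X A ω = N} :=
    (prob_compl_eq_zero_iff (MeasurableSet.iUnion hmeas)).2 hmass
  filter_upwards [hfinite] with ω hω
  obtain ⟨N, hN⟩ := Set.mem_iUnion.1 hω
  exact (show count X A ω = N from hN) ▸ ENat.natCast_ne_top N

variable {ι : Type*} {A : ι → Set Plane}

lemma measurable_toNat_count (hX : ∀ n, Measurable (X n)) (hA : ∀ j, MeasurableSet (A j)) :
    Measurable fun ω j ↦ (count X (A j) ω).toNat :=
  measurable_pi_lambda _ fun j ↦ (measurable_of_countable _).comp (measurable_count hX (hA j))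

variable [Fintype ι]

lemma IsPoissonPointProcess.map_count [IsProbabilityMeasure μ]
    (hX : IsPoissonPointProcess μ lam X) (hA : ∀ j, MeasurableSet (A j))
    (hb : ∀ j, Bornology.IsBounded (A j)) (hd : Pairwise fun j l ↦ Disjoint (A j) (A l)) :
    μ.map (fun ω j ↦ (count X (A j) ω).toNat) =
      Measure.pi fun j ↦ poissonMeasure (lam * (volume (A j)).toReal).toNNReal := by
  refine Measure.ext_of_singleton fun N ↦ ?_
  let e := Fintype.equivFin ι
  have hlaw := hX.count_law (Fintype.card ι) (A ∘ e.symm) (fun i ↦ hA _) (fun i ↦ hb _)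
    (fun i l hil ↦ hd (e.symm.injective.ne hil)) (N ∘ e.symm)
  rw [Measure.map_apply (measurable_toNat_count hX.measurable hA) (measurableSet_singleton _),
    Measure.pi_singleton, ← Equiv.prod_comp e.symm]
  refine Eq.trans (measure_congr ?_) hlaw
  filter_upwards [ae_all_iff.2 fun j ↦ hX.ae_count_ne_top (hA j) (hb j)] with ω hω
  refine propext (funext_iff.trans (e.symm.forall_congr_right.symm.trans ?_))
  refine forall_congr' fun i ↦ ?_
  rw [← ENat.natCast_inj, ENat.natCast_toNat (hω _)]
  rfl

lemma IsPoissonPointProcess.lintegral_prod_count [IsProbabilityMeasure μ]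
    (hX : IsPoissonPointProcess μ lam X) (hA : ∀ j, MeasurableSet (A j))
    (hb : ∀ j, Bornology.IsBounded (A j)) (hd : Pairwise fun j l ↦ Disjoint (A j) (A l))
    (F : ι → ℕ∞ → ℝ≥0∞) :
    ∫⁻ ω, ∏ j, F j (count X (A j) ω) ∂μ =
      ∏ j, ∫⁻ n : ℕ, F j n ∂(poissonMeasure (lam * (volume (A j)).toReal).toNNReal) := by
  set ν : ι → Measure ℕ := fun j ↦ poissonMeasure (lam * (volume (A j)).toReal).toNNReal
  calc ∫⁻ ω, ∏ j, F j (count X (A j) ω) ∂μ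
      = ∫⁻ ω, ∏ j, F j ((count X (A j) ω).toNat : ℕ) ∂μ := by
        refine lintegral_congr_ae ?_
        filter_upwards [ae_all_iff.2 fun j ↦ hX.ae_count_ne_top (hA j) (hb j)] with ω hω
        simp_rw [ENat.natCast_toNat (hω _)]
    _ = ∫⁻ N, ∏ j, F j (N j : ℕ) ∂(Measure.pi ν) := by
        rw [← hX.map_count hA hb hd, lintegral_map (measurable_of_countable _)
          (measurable_toNat_count hX.measurable hA)]
    _ = ∏ j, ∫⁻ N, F j (N j : ℕ) ∂(Measure.pi ν) :=
        lintegral_prod_eq_prod_lintegral_of_indepFun Finset.univ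
          (fun j (N : ι → ℕ) ↦ F j (N j))
          (iIndepFun_pi (X := fun j (n : ℕ) ↦ F j n)
            fun j ↦ (measurable_of_countable _).aemeasurable)
          fun j ↦ measurable_of_countable _
    _ = ∏ j, ∫⁻ n : ℕ, F j n ∂(ν j) :=
        Finset.prod_congr rfl fun j _ ↦ (measurePreserving_eval ν j).lintegral_comp
          (f := fun n : ℕ ↦ F j n) (measurable_of_countable _)

end Count

/-- The exponential functional `exp (-∑ g (x i))` of a point configuration, given by an enumeration
`x`, in which a point at `y` costs `g y`. -/
noncomputable def expFunctional {ι α : Type*} (g : α → ℝ≥0∞) (x : ι → α) : ℝ≥0∞ :=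
  negExp (∑' i, g (x i))

/-- The exponential functional of the configuration `x` from which the point with index `n` has been
removed: the reduced Palm version of `expFunctional`. -/
noncomputable def reducedExpFunctional {ι α : Type*} (g : α → ℝ≥0∞) (x : ι → α) (n : ι) : ℝ≥0∞ :=
  expFunctional g fun m : {m // m ≠ n} ↦ x m

/-- The number `lam * ∫ (1 - exp (-g))`, whose decreasing exponential is the mean of the exponential
functional of a Poisson point process of intensity `lam`. -/
noncomputable def poissonExponent (lam : ℝ) (g : Plane → ℝ≥0∞) : ℝ≥0∞ :=
  ENNReal.ofReal lam * ∫⁻ x, (1 - negExp (g x))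

section ExpFunctional

variable {ι α : Type*}

lemma expFunctional_le_one (g : α → ℝ≥0∞) (x : ι → α) : expFunctional g x ≤ 1 :=
  negExp_le_one _

lemma expFunctional_anti (x : ι → α) : Antitone fun g : α → ℝ≥0∞ ↦ expFunctional g x :=
  fun _ _ hg ↦ negExp_antitone (ENNReal.tsum_le_tsum fun _ ↦ hg _)

lemma expFunctional_eq_zero {g : α → ℝ≥0∞} {x : ι → α} {i : ι} (hi : g (x i) = ⊤) :
    expFunctional g x = 0 := by
  rw [expFunctional, ENNReal.tsum_eq_top_of_eq_top ⟨i, hi⟩, negExp_top]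

lemma reducedExpFunctional_eq_zero {g : α → ℝ≥0∞} {x : ι → α} {n m : ι} (hm : m ≠ n)
    (htop : g (x m) = ⊤) : reducedExpFunctional g x n = 0 :=
  expFunctional_eq_zero (i := (⟨m, hm⟩ : {m // m ≠ n})) htop

@[fun_prop]
lemma measurable_expFunctional [Countable ι] [MeasurableSpace α] {g : α → ℝ≥0∞}
    (hg : Measurable g) : Measurable fun x : ι → α ↦ expFunctional g x :=
  measurable_negExp.comp (Measurable.tsum fun i ↦ hg.comp (measurable_pi_apply i))

@[fun_prop]
lemma measurable_reducedExpFunctional [Countable ι] [MeasurableSpace α] {g : α → ℝ≥0∞}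
    (hg : Measurable g) (n : ι) : Measurable fun x : ι → α ↦ reducedExpFunctional g x n :=
  (measurable_expFunctional hg).comp (by fun_prop)

lemma tendsto_expFunctional {s : ℕ → α → ℝ≥0∞} {g : α → ℝ≥0∞} (hs : Monotone s)
    (hlim : ∀ y, Tendsto (fun j ↦ s j y) atTop (𝓝 (g y))) (x : ι → α) :
    Tendsto (fun j ↦ expFunctional (s j) x) atTop (𝓝 (expFunctional g x)) :=
  (continuous_negExp.tendsto _).comp
    (tendsto_tsum_of_monotone (fun _ _ h _ ↦ hs h _) fun _ ↦ hlim _)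

lemma tsum_eq_add_tsum_ne (f : ι → ℝ≥0∞) (n : ι) : ∑' m, f m = f n + ∑' m : {m // m ≠ n}, f m := by
  rw [← ENNReal.summable.tsum_add_tsum_compl (s := {n}) ENNReal.summable, tsum_singleton]
  rfl

/-- Removing a point from a configuration with `k` points in `A`, where the cost is constantly `c`,
leaves `k - 1` points in `A`, and does not affect the points outside `A`. -/
lemma tsum_indicator_mul_reducedExpFunctional {g : α → ℝ≥0∞} {A : Set α} {c : ℝ≥0∞}
    (hc : ∀ y ∈ A, g y = c) (x : ι → α) :
    ∑' n, A.indicator (fun _ ↦ 1) (x n) * reducedExpFunctional g x n =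
      (∑' n, A.indicator (fun _ ↦ 1) (x n)) *
        negExp (c * ((∑' n, A.indicator (fun _ ↦ 1) (x n)) - 1)) *
          expFunctional (Aᶜ.indicator g) x := by
  rw [mul_assoc, ← ENNReal.tsum_mul_right]
  refine tsum_congr fun n ↦ ?_
  by_cases hn : x n ∈ A
  · have hcost : ∀ m, g (x m) = c * A.indicator (fun _ ↦ 1) (x m) + Aᶜ.indicator g (x m) :=
      fun m ↦ by by_cases hm : x m ∈ A <;> simp [hm, hc]
    congr 1
    rw [reducedExpFunctional, expFunctional, expFunctional, ← negExp_add,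
      tsum_eq_add_tsum_ne (fun m ↦ A.indicator (fun _ ↦ 1) (x m)) n,
      tsum_eq_add_tsum_ne (fun m ↦ Aᶜ.indicator g (x m)) n]
    simp [hn, hcost, ENNReal.tsum_add, ENNReal.tsum_mul_left]
  · simp [hn]

end ExpFunctional

section SimpleFunc

variable {α : Type*} [MeasurableSpace α]

lemma sum_mul_indicator_fiber_simpleFunc (g : SimpleFunc α ℝ≥0∞) (y : α) :
    ∑ c ∈ g.range.erase 0, c * (g ⁻¹' {c}).indicator (fun _ ↦ 1) y = g y := by
  classical
  simp only [Set.indicator_apply, Set.mem_preimage, Set.mem_singleton_iff, mul_ite, mul_one,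
    mul_zero, Finset.sum_ite_eq]
  by_cases hy : g y = 0 <;> simp [hy]

lemma expFunctional_simpleFunc {ι : Type*} (g : SimpleFunc α ℝ≥0∞) (x : ι → α) :
    expFunctional g x = ∏ c : g.range.erase 0,
      negExp (c * ∑' n, (g ⁻¹' {(c : ℝ≥0∞)}).indicator (fun _ ↦ 1) (x n)) := by
  rw [expFunctional, ← negExp_sum, Finset.sum_coe_sort (g.range.erase 0)
    (fun c ↦ c * ∑' n, (g ⁻¹' {c}).indicator (fun _ ↦ 1) (x n))]
  simp_rw [← ENNReal.tsum_mul_left]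
  rw [← Summable.tsum_finsetSum fun _ _ ↦ ENNReal.summable]
  simp_rw [sum_mul_indicator_fiber_simpleFunc]

lemma poissonExponent_simpleFunc (lam : ℝ) (g : SimpleFunc Plane ℝ≥0∞) :
    poissonExponent lam g = ∑ c : g.range.erase 0,
      ENNReal.ofReal lam * volume (g ⁻¹' {(c : ℝ≥0∞)}) * (1 - negExp c) := by
  have hint := (g.map (fun c ↦ 1 - negExp c)).lintegral_eq_lintegral (volume : Measure Plane)
  rw [SimpleFunc.map_lintegral] at hint
  simp only [SimpleFunc.map_apply] at hint
  rw [poissonExponent, hint, Finset.sum_coe_sort (g.range.erase 0)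
    (fun c ↦ ENNReal.ofReal lam * volume (g ⁻¹' {c}) * (1 - negExp c)), Finset.mul_sum,
    ← Finset.sum_erase _ (a := 0) (by simp)]
  exact Finset.sum_congr rfl fun c _ ↦ by ring

lemma exists_monotone_simpleFunc_isBounded [PseudoMetricSpace α] [OpensMeasurableSpace α]
    [Nonempty α] {g : α → ℝ≥0∞} (hg : Measurable g) :
    ∃ s : ℕ → SimpleFunc α ℝ≥0∞, (∀ j, Bornology.IsBounded (Function.support (s j))) ∧
      Monotone (fun j ↦ ⇑(s j)) ∧ ∀ y, Tendsto (fun j ↦ s j y) atTop (𝓝 (g y)) := by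
  let o : α := Classical.arbitrary α
  let s : ℕ → SimpleFunc α ℝ≥0∞ := fun j ↦ (SimpleFunc.eapprox g j).restrict (Metric.ball o j)
  have hs : ∀ j, ⇑(s j) = (Metric.ball o j).indicator (SimpleFunc.eapprox g j) := fun j ↦
    SimpleFunc.coe_restrict _ measurableSet_ball
  refine ⟨s, fun j ↦ ?_, fun i j hij y ↦ ?_, fun y ↦ ?_⟩
  · rw [hs]
    exact Metric.isBounded_ball.subset Set.support_indicator_subset
  · simp only [hs]
    exact (Set.indicator_le_indicator_of_subset (Metric.ball_subset_ball (by exact_mod_cast hij))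
      (fun _ ↦ zero_le) y).trans
      (Set.indicator_le_indicator (SimpleFunc.monotone_eapprox g hij y))
  · refine (SimpleFunc.tendsto_eapprox hg y).congr' ?_
    obtain ⟨N, hN⟩ := exists_nat_gt (dist y o)
    filter_upwards [eventually_ge_atTop N] with j hj
    rw [hs, Set.indicator_of_mem (Metric.mem_ball.2 (hN.trans_le (by exact_mod_cast hj)))]

end SimpleFunc

section PoissonFunctional

lemma tendsto_poissonExponent (lam : ℝ) {s : ℕ → Plane → ℝ≥0∞} {g : Plane → ℝ≥0∞}
    (hmeas : ∀ j, Measurable (s j)) (hs : Monotone s)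
    (hlim : ∀ y, Tendsto (fun j ↦ s j y) atTop (𝓝 (g y))) :
    Tendsto (fun j ↦ poissonExponent lam (s j)) atTop (𝓝 (poissonExponent lam g)) := by
  refine ENNReal.Tendsto.const_mul ?_ (Or.inr ENNReal.ofReal_ne_top)
  refine lintegral_tendsto_of_tendsto_of_monotone (fun j ↦ ?_) (ae_of_all _ fun y i j hij ↦ ?_)
    (ae_of_all _ fun y ↦ ?_)
  · exact (measurable_const.sub (measurable_negExp.comp (hmeas j))).aemeasurable
  · exact tsub_le_tsub_left (negExp_antitone (hs hij y)) _
  · exact ENNReal.Tendsto.sub tendsto_const_nhds ((continuous_negExp.tendsto _).comp (hlim y))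
      (Or.inl ENNReal.one_ne_top)

variable {Ω : Type*} [MeasurableSpace Ω] {μ : Measure Ω} [IsProbabilityMeasure μ] {lam : ℝ}
  {X : ℕ → Ω → Plane}

/-- The simple function `g` contributes independent Poisson counts on its non-zero fibres, which are
disjoint from `A`. -/
lemma IsPoissonPointProcess.lintegral_count_mul_expFunctional_simpleFunc
    (hX : IsPoissonPointProcess μ lam X) {A : Set Plane} (hA : MeasurableSet A)
    (hb : Bornology.IsBounded A) (φ : ℕ∞ → ℝ≥0∞) {g : SimpleFunc Plane ℝ≥0∞}
    (hgb : Bornology.IsBounded (Function.support g)) (hgA : ∀ x ∈ A, g x = 0) :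
    ∫⁻ ω, φ (count X A ω) * expFunctional g (X · ω) ∂μ =
      (∫⁻ n : ℕ, φ n ∂(poissonMeasure (lam * (volume A).toReal).toNNReal)) *
        negExp (poissonExponent lam g) := by
  let S : Option (g.range.erase 0) → Set Plane := fun o ↦ o.elim A fun c ↦ g ⁻¹' {(c : ℝ≥0∞)}
  let F : Option (g.range.erase 0) → ℕ∞ → ℝ≥0∞ := fun o ↦ o.elim φ fun c k ↦ negExp (c * k)
  have hne : ∀ c : g.range.erase 0, (c : ℝ≥0∞) ≠ 0 := fun c ↦ (Finset.mem_erase.1 c.2).1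
  have hSm : ∀ o, MeasurableSet (S o) := fun
    | none => hA
    | some c => g.measurableSet_fiber c
  have hSb : ∀ o, Bornology.IsBounded (S o) := fun
    | none => hb
    | some c => hgb.subset fun x hx ↦ ne_of_eq_of_ne hx (hne c)
  have hSd : Pairwise fun j l ↦ Disjoint (S j) (S l) := by
    refine fun j l hjl ↦ Set.disjoint_left.2 fun x hj hl ↦ ?_
    rcases j with _ | c <;> rcases l with _ | d
    · exact hjl rfl
    · exact hne d ((show g x = d from hl).symm.trans (hgA x hj))
    · exact hne c ((show g x = c from hj).symm.trans (hgA x hl))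
    · exact hjl (congrArg some (Subtype.ext ((show g x = c from hj).symm.trans hl)))
  have hpgf : ∀ c : g.range.erase 0,
      ∫⁻ n : ℕ, F (some c) n ∂(poissonMeasure (lam * (volume (S (some c))).toReal).toNNReal) =
        negExp (ENNReal.ofReal lam * volume (g ⁻¹' {(c : ℝ≥0∞)}) * (1 - negExp c)) := fun c ↦ by
    simp only [F, Option.elim_some, ENat.toENNReal_coe, negExp_mul_natCast]
    rw [lintegral_pow_poissonMeasure _ (negExp_le_one _), ← ENNReal.ofReal,
      ENNReal.ofReal_mul' ENNReal.toReal_nonneg, ENNReal.ofReal_toReal (hSb _).measure_lt_top.ne]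
    rfl
  have hcounts := hX.lintegral_prod_count hSm hSb hSd F
  simp only [Fintype.prod_option, hpgf] at hcounts
  rw [poissonExponent_simpleFunc, negExp_sum]
  simp_rw [expFunctional_simpleFunc, ← toENNReal_count]
  exact hcounts

lemma IsPoissonPointProcess.lintegral_expFunctional (hX : IsPoissonPointProcess μ lam X)
    {g : Plane → ℝ≥0∞} (hg : Measurable g) :
    ∫⁻ ω, expFunctional g (X · ω) ∂μ = negExp (poissonExponent lam g) := by
  obtain ⟨s, hsb, hs, hlim⟩ := exists_monotone_simpleFunc_isBounded hg
  have hsimple : ∀ j, ∫⁻ ω, expFunctional (s j) (X · ω) ∂μ = negExp (poissonExponent lam (s j)) :=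
    fun j ↦ by
      simpa using hX.lintegral_count_mul_expFunctional_simpleFunc MeasurableSet.empty
        Bornology.isBounded_empty (fun _ ↦ 1) (hsb j) (by simp)
  have hmeas := hX.measurable
  refine tendsto_nhds_unique (tendsto_lintegral_of_dominated_convergence (fun _ ↦ 1)
    (fun j ↦ ?_) (fun j ↦ ae_of_all _ fun ω ↦ expFunctional_le_one _ _) (by simp)
    (ae_of_all _ fun ω ↦ tendsto_expFunctional hs hlim _)) ?_
  · exact (measurable_expFunctional (s j).measurable).comp (measurable_pi_lambda _ hmeas)
  · simp_rw [hsimple]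
    exact (continuous_negExp.tendsto _).comp
      (tendsto_poissonExponent lam (fun j ↦ (s j).measurable) hs hlim)

end PoissonFunctional

section ReducedCampbell

lemma poissonExponent_eq_add_of_const {g : Plane → ℝ≥0∞} {A : Set Plane} (hA : MeasurableSet A)
    {c : ℝ≥0∞} (hc : ∀ y ∈ A, g y = c) (lam : ℝ) :
    poissonExponent lam g = ENNReal.ofReal lam * volume A * (1 - negExp c) +
      poissonExponent lam (Aᶜ.indicator g) := by
  have hcompl : ∫⁻ y, (1 - negExp (Aᶜ.indicator g y)) = ∫⁻ y in Aᶜ, (1 - negExp (g y)) := by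
    rw [← lintegral_indicator hA.compl]
    refine lintegral_congr fun y ↦ ?_
    by_cases hy : y ∈ A <;> simp [hy]
  rw [poissonExponent, poissonExponent, hcompl, ← lintegral_add_compl _ hA, mul_add,
    setLIntegral_congr_fun hA fun y hy ↦ by rw [hc y hy], setLIntegral_const]
  ring

variable {Ω : Type*} [MeasurableSpace Ω] {μ : Measure Ω} [IsProbabilityMeasure μ] {lam : ℝ}
  {X : ℕ → Ω → Plane}

lemma IsPoissonPointProcess.lintegral_tsum_indicator_mul_reducedExpFunctional_of_const
    (hX : IsPoissonPointProcess μ lam X) {A : Set Plane} (hA : MeasurableSet A)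
    (hb : Bornology.IsBounded A) {g : SimpleFunc Plane ℝ≥0∞}
    (hgb : Bornology.IsBounded (Function.support g)) {c : ℝ≥0∞} (hc : ∀ y ∈ A, g y = c) :
    ∫⁻ ω, ∑' n, A.indicator (fun _ ↦ 1) (X n ω) * reducedExpFunctional g (X · ω) n ∂μ =
      ENNReal.ofReal lam * volume A * negExp (poissonExponent lam g) := by
  let φ : ℕ∞ → ℝ≥0∞ := fun k ↦ k * negExp (c * (k - 1))
  have hcompl : ⇑(g.restrict Aᶜ) = Aᶜ.indicator g := SimpleFunc.coe_restrict _ hA.compl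
  have hφ : ∫⁻ n : ℕ, φ n ∂(poissonMeasure (lam * (volume A).toReal).toNNReal) =
      ENNReal.ofReal lam * volume A *
        negExp (ENNReal.ofReal lam * volume A * (1 - negExp c)) := by
    simp only [φ, ENat.toENNReal_coe]
    have hpred : ∀ n : ℕ, (n : ℝ≥0∞) * negExp (c * (n - 1)) = n * negExp c ^ (n - 1) := fun n ↦ by
      rw [← negExp_mul_natCast]
      norm_cast
    simp_rw [hpred]
    rw [lintegral_natCast_mul_poissonMeasure _ (fun n ↦ negExp c ^ n),
      lintegral_pow_poissonMeasure _ (negExp_le_one _), ← ENNReal.ofReal,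
      ENNReal.ofReal_mul' ENNReal.toReal_nonneg, ENNReal.ofReal_toReal hb.measure_lt_top.ne]
  simp_rw [tsum_indicator_mul_reducedExpFunctional hc, ← toENNReal_count, ← hcompl]
  rw [hX.lintegral_count_mul_expFunctional_simpleFunc hA hb φ
    (hgb.subset (by simp [hcompl])) (fun x hx ↦ by simp [hcompl, hx]), hφ, hcompl,
    poissonExponent_eq_add_of_const hA hc, negExp_add, mul_assoc]

lemma measurable_indicator_mul_reducedExpFunctional (hX : ∀ n, Measurable (X n)) {A : Set Plane}
    (hA : MeasurableSet A) {g : Plane → ℝ≥0∞} (hg : Measurable g) (n : ℕ) :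
    Measurable fun ω ↦ A.indicator (fun _ ↦ 1) (X n ω) * reducedExpFunctional g (X · ω) n :=
  ((measurable_const.indicator hA).comp (hX n)).mul
    ((measurable_reducedExpFunctional hg n).comp (measurable_pi_lambda _ hX))

lemma IsPoissonPointProcess.lintegral_tsum_indicator_mul_reducedExpFunctional_simpleFunc
    (hX : IsPoissonPointProcess μ lam X) {A : Set Plane} (hA : MeasurableSet A)
    (hb : Bornology.IsBounded A) {g : SimpleFunc Plane ℝ≥0∞}
    (hgb : Bornology.IsBounded (Function.support g)) :
    ∫⁻ ω, ∑' n, A.indicator (fun _ ↦ 1) (X n ω) * reducedExpFunctional g (X · ω) n ∂μ =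
      ENNReal.ofReal lam * volume A * negExp (poissonExponent lam g) := by
  classical
  let S : ℝ≥0∞ → Set Plane := fun c ↦ A ∩ g ⁻¹' {c}
  have hS : ∀ c, MeasurableSet (S c) := fun c ↦ hA.inter (g.measurableSet_fiber c)
  have hsplit : ∀ y, A.indicator (fun _ ↦ (1 : ℝ≥0∞)) y =
      ∑ c ∈ g.range, (S c).indicator (fun _ ↦ 1) y := fun y ↦ by
    by_cases hy : y ∈ A <;> simp [S, Set.indicator_apply, hy]
  have hvol : volume A = ∑ c ∈ g.range, volume (S c) := by
    have := lintegral_finsetSum g.range (μ := volume) (f := fun c ↦ (S c).indicator fun _ ↦ 1)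
      fun c _ ↦ measurable_const.indicator (hS c)
    simp_rw [← hsplit, lintegral_indicator hA, lintegral_indicator (hS _), setLIntegral_one] at this
    exact this
  simp_rw [hsplit, Finset.sum_mul]
  simp_rw [Summable.tsum_finsetSum fun _ _ ↦ ENNReal.summable]
  rw [lintegral_finsetSum _ fun c _ ↦ Measurable.tsum
    (measurable_indicator_mul_reducedExpFunctional hX.measurable (hS c) g.measurable), hvol,
    Finset.mul_sum, Finset.sum_mul]
  exact Finset.sum_congr rfl fun c _ ↦
    hX.lintegral_tsum_indicator_mul_reducedExpFunctional_of_const (hS c)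
      (hb.subset Set.inter_subset_left) hgb fun y hy ↦ hy.2

lemma IsPoissonPointProcess.lintegral_tsum_indicator (hX : IsPoissonPointProcess μ lam X)
    {A : Set Plane} (hA : MeasurableSet A) (hb : Bornology.IsBounded A) :
    ∫⁻ ω, ∑' n, A.indicator (fun _ ↦ 1) (X n ω) ∂μ = ENNReal.ofReal lam * volume A := by
  have := hX.lintegral_tsum_indicator_mul_reducedExpFunctional_simpleFunc hA hb (g := 0)
    (by simp)
  simpa [reducedExpFunctional, expFunctional, poissonExponent] using this

/-- The reduced Campbell formula: by Slivnyak's theorem, the configuration seen from a point of a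
Poisson point process, this point being removed, is again the same Poisson point process. -/
lemma IsPoissonPointProcess.lintegral_tsum_indicator_mul_reducedExpFunctional
    (hX : IsPoissonPointProcess μ lam X) {A : Set Plane} (hA : MeasurableSet A)
    (hb : Bornology.IsBounded A) {g : Plane → ℝ≥0∞} (hg : Measurable g) :
    ∫⁻ ω, ∑' n, A.indicator (fun _ ↦ 1) (X n ω) * reducedExpFunctional g (X · ω) n ∂μ =
      ENNReal.ofReal lam * volume A * negExp (poissonExponent lam g) := by
  obtain ⟨s, hsb, hs, hlim⟩ := exists_monotone_simpleFunc_isBounded hg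
  have hsimple := fun j ↦
    hX.lintegral_tsum_indicator_mul_reducedExpFunctional_simpleFunc hA hb (hsb j)
  have hmass : ENNReal.ofReal lam * volume A ≠ ⊤ :=
    ENNReal.mul_ne_top ENNReal.ofReal_ne_top hb.measure_lt_top.ne
  have hmean := hX.lintegral_tsum_indicator hA hb
  have hle : ∀ j ω n, A.indicator (fun _ ↦ 1) (X n ω) * reducedExpFunctional (s j) (X · ω) n ≤
      A.indicator (fun _ ↦ 1) (X n ω) := fun j ω n ↦
    mul_le_of_le_one_right' (expFunctional_le_one _ _)
  have hpoint : ∀ᵐ ω ∂μ, Tendsto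
      (fun j ↦ ∑' n, A.indicator (fun _ ↦ 1) (X n ω) * reducedExpFunctional (s j) (X · ω) n) atTop
      (𝓝 (∑' n, A.indicator (fun _ ↦ 1) (X n ω) * reducedExpFunctional g (X · ω) n)) := by
    filter_upwards [hX.ae_count_ne_top hA hb] with ω hω
    refine tendsto_tsum_of_dominated (fun j n ↦ hle j ω n) ?_ fun n ↦
      ENNReal.Tendsto.const_mul (tendsto_expFunctional hs hlim _) (Or.inr ?_)
    · rwa [← toENNReal_count, ENat.toENNReal_ne_top]
    · by_cases hn : X n ω ∈ A <;> simp [hn]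
  refine tendsto_nhds_unique (tendsto_lintegral_of_dominated_convergence _
    (fun j ↦ Measurable.tsum (measurable_indicator_mul_reducedExpFunctional hX.measurable hA
      (s j).measurable))
    (fun j ↦ ae_of_all _ fun ω ↦ ENNReal.tsum_le_tsum (hle j ω)) (hmean ▸ hmass) hpoint) ?_
  simp_rw [hsimple]
  exact ENNReal.Tendsto.const_mul ((continuous_negExp.tendsto _).comp
    (tendsto_poissonExponent lam (fun j ↦ (s j).measurable) hs hlim)) (Or.inr hmass)

lemma IsPoissonPointProcess.ae_forall_notMem (hX : IsPoissonPointProcess μ lam X)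
    {A : Set Plane} (hA : MeasurableSet A) (hb : Bornology.IsBounded A) (hvol : volume A = 0) :
    ∀ᵐ ω ∂μ, ∀ n, X n ω ∉ A := by
  have hmeas : Measurable fun ω ↦ ∑' n, A.indicator (fun _ ↦ (1 : ℝ≥0∞)) (X n ω) :=
    Measurable.tsum fun n ↦ (measurable_const.indicator hA).comp (hX.measurable n)
  have hzero := hX.lintegral_tsum_indicator hA hb
  rw [hvol, mul_zero, lintegral_eq_zero_iff hmeas] at hzero
  filter_upwards [hzero] with ω hω n hn
  simpa [hn] using ENNReal.tsum_eq_zero.1 hω n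

end ReducedCampbell

/-- The levels `ρ n x` and the values `f s n x`, decreasing in the frozen level `s`, satisfy a
Campbell formula at each frozen level: the values at the level `s`, summed over the indices with
`ρ n x ∈ [u, v)`, integrate to `c * (v - u) * F s`. -/
structure HasShellIntegrals {α ι : Type*} [MeasurableSpace α] (ν : Measure α) (ρ : ι → α → ℝ)
    (f : ℝ → ι → α → ℝ≥0∞) (c : ℝ≥0∞) (F : ℝ → ℝ≥0∞) : Prop where
  measurable_level : ∀ n, Measurable (ρ n)
  level_nonneg : ∀ n x, 0 ≤ ρ n x
  measurable : ∀ s n, Measurable (f s n)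
  antitoneOn : ∀ n x, AntitoneOn (fun s ↦ f s n x) (Set.Ici 0)
  lintegral_shell : ∀ s u v, 0 ≤ s → 0 ≤ u → u ≤ v →
    ∫⁻ x, ∑' n, (Set.Ico u v).indicator (fun _ ↦ 1) (ρ n x) * f s n x ∂ν =
      c * ENNReal.ofReal (v - u) * F s

section Shells

lemma tsum_indicator_Ico_mul {d t : ℝ} (hd : 0 < d) (ht : 0 ≤ t) (a : ℕ → ℝ≥0∞) :
    ∑' j : ℕ, (Set.Ico (d * j) (d * (j + 1))).indicator (fun _ ↦ 1) t * a j = a ⌊t / d⌋₊ := by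
  have hmem : ∀ j : ℕ, t ∈ Set.Ico (d * j) (d * (j + 1)) ↔ j = ⌊t / d⌋₊ := fun j ↦ by
    rw [eq_comm, Nat.floor_eq_iff (div_nonneg ht hd.le), le_div_iff₀' hd, div_lt_iff₀' hd]
    rfl
  simp [Set.indicator_apply, hmem]

variable {α ι : Type*} [MeasurableSpace α] [Countable ι] {ν : Measure α} {ρ : ι → α → ℝ}
  {f : ℝ → ι → α → ℝ≥0∞} {c : ℝ≥0∞} {F : ℝ → ℝ≥0∞}

lemma HasShellIntegrals.lintegral_tsum_floor (hf : HasShellIntegrals ν ρ f c F) {d : ℝ}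
    (hd : 0 < d) {a : ℕ → ℝ} (ha : ∀ j, 0 ≤ a j) :
    ∫⁻ x, ∑' n, f (a ⌊ρ n x / d⌋₊) n x ∂ν = ∑' j, c * ENNReal.ofReal d * F (a j) := by
  have hcells : ∀ x, ∑' n, f (a ⌊ρ n x / d⌋₊) n x = ∑' j : ℕ, ∑' n,
      (Set.Ico (d * j) (d * (j + 1))).indicator (fun _ ↦ 1) (ρ n x) * f (a j) n x := fun x ↦ by
    rw [ENNReal.tsum_comm]
    exact tsum_congr fun n ↦
      (tsum_indicator_Ico_mul hd (hf.level_nonneg n x) fun j ↦ f (a j) n x).symm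
  have hmeas : ∀ j : ℕ, Measurable fun x ↦ ∑' n,
      (Set.Ico (d * j) (d * (j + 1))).indicator (fun _ ↦ 1) (ρ n x) * f (a j) n x := fun j ↦
    Measurable.tsum fun n ↦ ((measurable_const.indicator measurableSet_Ico).comp
      (hf.measurable_level n)).mul (hf.measurable _ n)
  simp_rw [hcells]
  rw [lintegral_tsum fun j ↦ (hmeas j).aemeasurable]
  refine tsum_congr fun j ↦ ?_
  rw [hf.lintegral_shell _ _ _ (ha j) (by positivity) (by gcongr; simp)]
  ring_nf

lemma HasShellIntegrals.lintegral_tsum_le (hf : HasShellIntegrals ν ρ f c F) {d : ℝ}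
    (hd : 0 < d) :
    ∫⁻ x, ∑' n, f (ρ n x) n x ∂ν ≤ ∑' j : ℕ, c * ENNReal.ofReal d * F (d * j) := by
  rw [← hf.lintegral_tsum_floor hd fun j ↦ by positivity]
  refine lintegral_mono fun x ↦ ENNReal.tsum_le_tsum fun n ↦
    hf.antitoneOn n x (Set.mem_Ici.2 (by positivity)) (hf.level_nonneg n x) ?_
  rw [← le_div_iff₀' hd]
  exact Nat.floor_le (div_nonneg (hf.level_nonneg n x) hd.le)

lemma HasShellIntegrals.le_lintegral_tsum (hf : HasShellIntegrals ν ρ f c F) {d : ℝ}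
    (hd : 0 < d) :
    ∑' j : ℕ, c * ENNReal.ofReal d * F (d * (j + 1 : ℕ)) ≤ ∫⁻ x, ∑' n, f (ρ n x) n x ∂ν := by
  rw [← hf.lintegral_tsum_floor hd (a := fun j ↦ d * (j + 1 : ℕ)) fun j ↦ by positivity]
  refine lintegral_mono fun x ↦ ENNReal.tsum_le_tsum fun n ↦
    hf.antitoneOn n x (hf.level_nonneg n x) (Set.mem_Ici.2 (by positivity)) ?_
  rw [← div_le_iff₀' hd]
  exact_mod_cast (Nat.lt_floor_add_one _).le

lemma HasShellIntegrals.lintegral_tsum_le_lintegral_tsum {β κ : Type*} [MeasurableSpace β]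
    [Countable κ] {ν' : Measure β} {ρ' : κ → β → ℝ} {f' : ℝ → κ → β → ℝ≥0∞}
    (hf : HasShellIntegrals ν ρ f c F) (hf' : HasShellIntegrals ν' ρ' f' c F)
    (hc : c ≠ ⊤) (hF : F 0 ≠ ⊤) :
    ∫⁻ x, ∑' n, f (ρ n x) n x ∂ν ≤ ∫⁻ x, ∑' n, f' (ρ' n x) n x ∂ν' := by
  have hbound : ∀ d : ℝ, 0 < d → ∫⁻ x, ∑' n, f (ρ n x) n x ∂ν ≤
      c * ENNReal.ofReal d * F 0 + ∫⁻ x, ∑' n, f' (ρ' n x) n x ∂ν' := fun d hd ↦ by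
    refine (hf.lintegral_tsum_le hd).trans ?_
    rw [tsum_eq_zero_add' ENNReal.summable, Nat.cast_zero, mul_zero]
    exact add_le_add le_rfl (hf'.le_lintegral_tsum hd)
  have hlim : Tendsto (fun d : ℝ ↦ c * ENNReal.ofReal d * F 0 +
      ∫⁻ x, ∑' n, f' (ρ' n x) n x ∂ν') (𝓝[>] 0) (𝓝 (∫⁻ x, ∑' n, f' (ρ' n x) n x ∂ν')) := by
    have hcont : Continuous fun d : ℝ ↦
        c * ENNReal.ofReal d * F 0 + ∫⁻ x, ∑' n, f' (ρ' n x) n x ∂ν' :=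
      ((ENNReal.continuous_mul_const hF).comp
        ((ENNReal.continuous_const_mul hc).comp ENNReal.continuous_ofReal)).add continuous_const
    simpa using (hcont.tendsto 0).mono_left nhdsWithin_le_nhds
  exact ge_of_tendsto hlim (eventually_mem_nhdsWithin.mono hbound)

lemma hasShellIntegrals_Ici (c : ℝ≥0∞) (hF : AntitoneOn F (Set.Ici 0)) :
    HasShellIntegrals (volume.restrict (Set.Ici 0)) (fun (_ : Unit) t ↦ |t|)
      (fun s _ _ ↦ c * F s) c F where
  measurable_level _ := by fun_prop
  level_nonneg _ _ := abs_nonneg _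
  measurable _ _ := measurable_const
  antitoneOn _ _ _ hs _ ht hst := mul_le_mul_right (hF hs ht hst) c
  lintegral_shell s u v _ hu _ := by
    have hshell : ∫⁻ t in Set.Ici 0, (Set.Ico u v).indicator (fun _ ↦ (1 : ℝ≥0∞)) |t| =
        ENNReal.ofReal (v - u) := by
      rw [setLIntegral_congr_fun measurableSet_Ici fun t ht ↦ by rw [abs_of_nonneg ht],
        lintegral_indicator measurableSet_Ico, setLIntegral_one,
        Measure.restrict_eq_self _ (Set.Ico_subset_Ici_self.trans (Set.Ici_subset_Ici.2 hu)),
        Real.volume_Ico]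
    have hmeas : Measurable fun t : ℝ ↦ (Set.Ico u v).indicator (fun _ ↦ (1 : ℝ≥0∞)) |t| :=
      (measurable_const.indicator measurableSet_Ico).comp measurable_norm
    simp_rw [tsum_fintype, Finset.univ_unique, Finset.sum_singleton]
    rw [lintegral_mul_const _ hmeas, hshell]
    ring

lemma HasShellIntegrals.lintegral_tsum (hf : HasShellIntegrals ν ρ f c F) (hc : c ≠ ⊤)
    (hF : AntitoneOn F (Set.Ici 0)) (hF0 : F 0 ≠ ⊤) :
    ∫⁻ x, ∑' n, f (ρ n x) n x ∂ν = ∫⁻ s in Set.Ioi 0, c * F s := by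
  have hlevel : ∫⁻ s in Set.Ici 0, ∑' _ : Unit, c * F |s| = ∫⁻ s in Set.Ioi 0, c * F s := by
    rw [← setLIntegral_congr Ioi_ae_eq_Ici]
    refine setLIntegral_congr_fun measurableSet_Ioi fun s hs ↦ ?_
    simp [abs_of_pos (Set.mem_Ioi.1 hs)]
  have hIci := hasShellIntegrals_Ici c hF
  rw [← hlevel]
  exact le_antisymm (hf.lintegral_tsum_le_lintegral_tsum hIci hc hF0)
    (hIci.lintegral_tsum_le_lintegral_tsum hf hc hF0)

end Shells

section SquaredNorm

lemma setOf_normSq_lt (b : ℝ) : {x : Plane | ‖x‖ ^ 2 < b} = Metric.ball 0 (√b) := by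
  ext x
  rw [mem_ball_zero_iff]
  exact (Real.lt_sqrt (norm_nonneg x)).symm

lemma volume_normSq_lt (b : ℝ) :
    volume {x : Plane | ‖x‖ ^ 2 < b} = ENNReal.ofReal Real.pi * ENNReal.ofReal b := by
  rw [setOf_normSq_lt, EuclideanSpace.volume_ball_fin_two, mul_comm,
    ← ENNReal.ofReal_pow (Real.sqrt_nonneg b), ← NNReal.coe_real_pi, ENNReal.ofReal_coe_nnreal]
  rcases le_total 0 b with hb | hb
  · rw [Real.sq_sqrt hb]
  · simp [Real.sqrt_eq_zero_of_nonpos hb, ENNReal.ofReal_of_nonpos hb]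

lemma isBounded_normSq_mem_Ico (u v : ℝ) :
    Bornology.IsBounded {x : Plane | ‖x‖ ^ 2 ∈ Set.Ico u v} :=
  (setOf_normSq_lt v ▸ Metric.isBounded_ball).subset fun _ hx ↦ hx.2

lemma measurableSet_normSq_mem_Ico (u v : ℝ) :
    MeasurableSet {x : Plane | ‖x‖ ^ 2 ∈ Set.Ico u v} :=
  measurableSet_Ico.preimage (f := fun x : Plane ↦ ‖x‖ ^ 2) (by fun_prop)

lemma volume_normSq_mem_Ico (u v : ℝ) :
    volume {x : Plane | ‖x‖ ^ 2 ∈ Set.Ico u v} =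
      ENNReal.ofReal Real.pi * (ENNReal.ofReal v - ENNReal.ofReal u) := by
  rcases le_total v u with hvu | huv
  · simp [Set.Ico_eq_empty_of_le hvu, tsub_eq_zero_of_le (ENNReal.ofReal_le_ofReal hvu)]
  have hdiff : {x : Plane | ‖x‖ ^ 2 ∈ Set.Ico u v} =
      {x : Plane | ‖x‖ ^ 2 < v} \ {x : Plane | ‖x‖ ^ 2 < u} := by
    ext x
    simp [and_comm]
  rw [hdiff, measure_sdiff (s₁ := {x : Plane | ‖x‖ ^ 2 < v}) (s₂ := {x : Plane | ‖x‖ ^ 2 < u})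
      (fun x (hx : ‖x‖ ^ 2 < u) ↦ hx.trans_le huv)
      (measurableSet_lt (by fun_prop) measurable_const).nullMeasurableSet
      (by rw [volume_normSq_lt]; finiteness),
    volume_normSq_lt, volume_normSq_lt, ENNReal.mul_sub fun _ _ ↦ ENNReal.ofReal_ne_top]

lemma map_normSq_volume :
    volume.map (fun x : Plane ↦ ‖x‖ ^ 2) =
      ENNReal.ofReal Real.pi • (volume : Measure ℝ).restrict (Set.Ici 0) := by
  have hIco : ∀ u v : ℝ, volume.map (fun x : Plane ↦ ‖x‖ ^ 2) (Set.Ico u v) =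
      ENNReal.ofReal Real.pi * (ENNReal.ofReal v - ENNReal.ofReal u) := fun u v ↦ by
    rw [Measure.map_apply (by fun_prop) measurableSet_Ico, ← volume_normSq_mem_Ico]
    rfl
  refine Measure.ext_of_Ico' _ _ (fun u v _ ↦ by rw [hIco]; finiteness) fun u v _ ↦ ?_
  rw [hIco, Measure.smul_apply, Measure.restrict_apply measurableSet_Ico, smul_eq_mul,
    Set.Ico_inter_Ici, Real.volume_Ico]
  rcases le_total 0 u with hu | hu
  · rw [sup_of_le_left hu, ENNReal.ofReal_sub _ hu]
  · rw [sup_of_le_right hu, ENNReal.ofReal_of_nonpos hu, tsub_zero, sub_zero]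

lemma lintegral_comp_normSq {φ : ℝ → ℝ≥0∞} (hφ : Measurable φ) :
    ∫⁻ x : Plane, φ (‖x‖ ^ 2) = ENNReal.ofReal Real.pi * ∫⁻ t in Set.Ici 0, φ t := by
  rw [← lintegral_map (g := fun x : Plane ↦ ‖x‖ ^ 2) hφ (by fun_prop), map_normSq_volume,
    lintegral_smul_measure, smul_eq_mul]

end SquaredNorm

/-- The cost of a BS at squared distance `t`, where BSs at squared distance at most `e` are
excluded, and the other ones interfere: Rayleigh fading, averaged over, turns the exponential
functional of a power `w * |h| ^ 2` into `(1 + w)⁻¹ = exp (-log (1 + w))`. The strength is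
normalized so that `θ` is the power received from a BS at the exclusion boundary. -/
noncomputable def exclusionCost (θ e t : ℝ) : ℝ≥0∞ :=
  if t ≤ e then ⊤ else ENNReal.ofReal (Real.log (1 + θ * (e / t) ^ 2))

/-- The factor by which interference of strength `θ` at the exclusion boundary increases the
exponent `lam * area` of the void probability of the excluded disc. -/
noncomputable def loadFactor (θ : ℝ) : ℝ := 1 + √θ * Real.arctan √θ

section ExclusionCost

variable {θ e t : ℝ}

lemma loadFactor_zero : loadFactor 0 = 1 := by simp [loadFactor]

lemma loadFactor_pos (θ : ℝ) : 0 < loadFactor θ := by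
  have : 0 ≤ Real.arctan √θ := Real.arctan_nonneg.2 (Real.sqrt_nonneg θ)
  unfold loadFactor
  positivity

@[fun_prop]
lemma measurable_exclusionCost (θ e : ℝ) : Measurable (exclusionCost θ e) :=
  Measurable.ite measurableSet_Iic measurable_const (by fun_prop)

lemma exclusionCost_eq_top (h : t ≤ e) : exclusionCost θ e t = ⊤ := if_pos h

lemma exclusionCost_of_lt (h : e < t) :
    exclusionCost θ e t = ENNReal.ofReal (Real.log (1 + θ * (e / t) ^ 2)) := if_neg h.not_ge

lemma monotoneOn_exclusionCost (hθ : 0 ≤ θ) (t : ℝ) :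
    MonotoneOn (fun e ↦ exclusionCost θ e t) (Set.Ici 0) := by
  intro e (he : 0 ≤ e) e' _ hee'
  rcases le_or_gt t e' with ht | ht
  · simp only [exclusionCost_eq_top ht, le_top]
  · have ht0 : 0 < t := (he.trans hee').trans_lt ht
    simp only [exclusionCost_of_lt ht, exclusionCost_of_lt (hee'.trans_lt ht)]
    gcongr

lemma one_sub_negExp_exclusionCost_of_lt (hθ : 0 ≤ θ) (h : e < t) :
    1 - negExp (exclusionCost θ e t) =
      ENNReal.ofReal (θ * (e / t) ^ 2 / (1 + θ * (e / t) ^ 2)) := by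
  have hw : 0 ≤ θ * (e / t) ^ 2 := by positivity
  rw [exclusionCost_of_lt h, negExp_ofReal (Real.log_nonneg (by linarith)), Real.exp_neg,
    Real.exp_log (by positivity), ← ENNReal.ofReal_one, ← ENNReal.ofReal_sub _ (by positivity)]
  congr 1
  field_simp
  ring

lemma lintegral_Ioi_inv_one_add_div_sq {c : ℝ} (hc : 0 < c) (e : ℝ) :
    ∫⁻ t in Set.Ioi e, ENNReal.ofReal (1 + (c⁻¹ * t) ^ 2)⁻¹ =
      ENNReal.ofReal (c * (Real.pi / 2 - Real.arctan (c⁻¹ * e))) := by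
  have hint : Integrable fun t : ℝ ↦ (1 + (c⁻¹ * t) ^ 2)⁻¹ :=
    integrable_inv_one_add_sq.comp_mul_left' (inv_ne_zero hc.ne')
  rw [← ofReal_integral_eq_lintegral_ofReal hint.integrableOn
      (ae_of_all _ fun t ↦ by positivity),
    integral_comp_mul_left_Ioi (fun t ↦ (1 + t ^ 2)⁻¹) e (inv_pos.2 hc),
    integral_Ioi_inv_one_add_sq, inv_inv, smul_eq_mul]

lemma lintegral_Ioi_one_sub_negExp_exclusionCost (hθ : 0 ≤ θ) (he : 0 ≤ e) :
    ∫⁻ t in Set.Ioi e, (1 - negExp (exclusionCost θ e t)) =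
      ENNReal.ofReal (e * (√θ * Real.arctan √θ)) := by
  rw [setLIntegral_congr_fun measurableSet_Ioi
    fun t ht ↦ one_sub_negExp_exclusionCost_of_lt hθ ht]
  rcases hθ.eq_or_lt with rfl | hθ
  · simp
  rcases he.eq_or_lt with rfl | he
  · simp
  have hs : 0 < √θ := Real.sqrt_pos.2 hθ
  calc ∫⁻ t in Set.Ioi e, ENNReal.ofReal (θ * (e / t) ^ 2 / (1 + θ * (e / t) ^ 2))
    _ = ∫⁻ t in Set.Ioi e, ENNReal.ofReal (1 + ((√θ * e)⁻¹ * t) ^ 2)⁻¹ := by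
        refine setLIntegral_congr_fun measurableSet_Ioi fun t ht ↦ ?_
        have ht0 : 0 < t := he.trans ht
        congr 1
        rw [mul_pow _ t, inv_pow, mul_pow, Real.sq_sqrt hθ.le]
        field_simp
        ring
    _ = ENNReal.ofReal (√θ * e * (Real.pi / 2 - Real.arctan (√θ)⁻¹)) := by
        rw [lintegral_Ioi_inv_one_add_div_sq (by positivity)]
        congr 4
        field_simp
    _ = ENNReal.ofReal (e * (√θ * Real.arctan √θ)) := by
        rw [Real.arctan_inv_of_pos hs]
        ring_nf

lemma lintegral_one_sub_negExp_exclusionCost (hθ : 0 ≤ θ) (he : 0 ≤ e) :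
    ∫⁻ t in Set.Ici 0, (1 - negExp (exclusionCost θ e t)) =
      ENNReal.ofReal (e * loadFactor θ) := by
  have hdisc : ∫⁻ t in Set.Icc 0 e, (1 - negExp (exclusionCost θ e t)) = ENNReal.ofReal e := by
    rw [setLIntegral_congr_fun (g := fun _ ↦ 1) measurableSet_Icc
      fun t ht ↦ by simp [exclusionCost_eq_top ht.2]]
    simp
  have : 0 ≤ Real.arctan √θ := Real.arctan_nonneg.2 (Real.sqrt_nonneg θ)
  rw [← Set.Icc_union_Ioi_eq_Ici he, lintegral_union measurableSet_Ioi
      (Set.disjoint_left.2 fun t ht ht' ↦ ht.2.not_gt ht'), hdisc,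
    lintegral_Ioi_one_sub_negExp_exclusionCost hθ he, ← ENNReal.ofReal_add he (by positivity),
    loadFactor, mul_add, mul_one]

lemma poissonExponent_exclusionCost (hθ : 0 ≤ θ) (he : 0 ≤ e) (lam : ℝ) :
    poissonExponent lam (fun x ↦ exclusionCost θ e (‖x‖ ^ 2)) =
      ENNReal.ofReal (lam * Real.pi * (e * loadFactor θ)) := by
  have hload := loadFactor_pos θ
  rw [poissonExponent, lintegral_comp_normSq (φ := fun t ↦ 1 - negExp (exclusionCost θ e t))
      (measurable_const.sub (measurable_negExp.comp (measurable_exclusionCost θ e))),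
    lintegral_one_sub_negExp_exclusionCost hθ he, ← mul_assoc,
    ← ENNReal.ofReal_mul' Real.pi_nonneg, ← ENNReal.ofReal_mul' (by positivity)]

end ExclusionCost

section Fading

lemma lintegral_exp_neg_sq_gaussianReal {w : ℝ} (hw : 0 ≤ w) :
    ∫⁻ x, ENNReal.ofReal (Real.exp (-(w * x ^ 2))) ∂(gaussianReal 0 (1 / 2)) =
      ENNReal.ofReal (√(1 + w))⁻¹ := by
  rw [← ofReal_integral_eq_lintegral_ofReal]
  · congr 1
    rw [integral_gaussianReal_eq_integral_smul (by simp)]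
    simp only [gaussianPDFReal, smul_eq_mul, sub_zero]
    have hdensity : ∀ x : ℝ, (√(2 * Real.pi * ((1 / 2 : ℝ≥0) : ℝ)))⁻¹ *
        Real.exp (-x ^ 2 / (2 * ((1 / 2 : ℝ≥0) : ℝ))) * Real.exp (-(w * x ^ 2)) =
        (√Real.pi)⁻¹ * Real.exp (-(1 + w) * x ^ 2) := fun x ↦ by
      rw [mul_assoc, ← Real.exp_add]
      congr 3
      · push_cast; ring
      · push_cast; ring
    simp_rw [hdensity]
    rw [integral_const_mul, integral_gaussian, Real.sqrt_div Real.pi_nonneg, div_eq_mul_inv,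
      ← mul_assoc, inv_mul_cancel₀ (by positivity), one_mul]
  · refine Integrable.of_bound (by fun_prop) 1 (ae_of_all _ fun x ↦ ?_)
    rw [Real.norm_of_nonneg (Real.exp_pos _).le, Real.exp_le_one_iff]
    exact neg_nonpos.2 (by positivity)
  · exact ae_of_all _ fun x ↦ (Real.exp_pos _).le

lemma lintegral_negExp_normSq_stdComplexGaussian {w : ℝ} (hw : 0 ≤ w) :
    ∫⁻ z, negExp (ENNReal.ofReal (w * ‖z‖ ^ 2)) ∂stdComplexGaussian =
      negExp (ENNReal.ofReal (Real.log (1 + w))) := by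
  have hsplit : ∀ p : ℝ × ℝ,
      negExp (ENNReal.ofReal (w * ‖Complex.measurableEquivRealProd.symm p‖ ^ 2)) =
      ENNReal.ofReal (Real.exp (-(w * p.1 ^ 2))) * ENNReal.ofReal (Real.exp (-(w * p.2 ^ 2))) :=
    fun p ↦ by
      rw [negExp_ofReal (by positivity), ← ENNReal.ofReal_mul (Real.exp_pos _).le, ← Real.exp_add,
        Complex.sq_norm, Complex.normSq_apply]
      congr 2
      simp [Complex.measurableEquivRealProd]
      ring
  rw [stdComplexGaussian, lintegral_map_equiv]
  simp_rw [hsplit]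
  rw [lintegral_prod_mul (f := fun x ↦ ENNReal.ofReal (Real.exp (-(w * x ^ 2))))
    (g := fun x ↦ ENNReal.ofReal (Real.exp (-(w * x ^ 2)))) (by fun_prop) (by fun_prop),
    lintegral_exp_neg_sq_gaussianReal hw, ← ENNReal.ofReal_mul (by positivity),
    negExp_ofReal (Real.log_nonneg (by linarith)), Real.exp_neg, Real.exp_log (by positivity),
    ← mul_inv, Real.mul_self_sqrt (by positivity)]

variable {Ω : Type*} [MeasurableSpace Ω] {μ : Measure Ω}

lemma lintegral_negExp_tsum_fading [IsProbabilityMeasure μ] {ι : Type*} [Countable ι]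
    {H : ι → Ω → ℂ} (hm : ∀ p, Measurable (H p)) (hlaw : ∀ p, μ.map (H p) = stdComplexGaussian)
    (hind : iIndepFun H μ) {w : ι → ℝ} (hw : ∀ p, 0 ≤ w p) :
    ∫⁻ ω, negExp (∑' p, ENNReal.ofReal (w p * ‖H p ω‖ ^ 2)) ∂μ =
      negExp (∑' p, ENNReal.ofReal (Real.log (1 + w p))) := by
  have hfin : ∀ s : Finset ι, ∫⁻ ω, negExp (∑ p ∈ s, ENNReal.ofReal (w p * ‖H p ω‖ ^ 2)) ∂μ =
      negExp (∑ p ∈ s, ENNReal.ofReal (Real.log (1 + w p))) := fun s ↦ by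
    simp_rw [negExp_sum]
    have hφ : ∀ p, Measurable fun z : ℂ ↦ negExp (ENNReal.ofReal (w p * ‖z‖ ^ 2)) :=
      fun p ↦ by fun_prop
    rw [lintegral_prod_eq_prod_lintegral_of_indepFun s
      (fun p ω ↦ negExp (ENNReal.ofReal (w p * ‖H p ω‖ ^ 2))) (hind.comp _ hφ)
      (fun p ↦ (hφ p).comp (hm p))]
    refine Finset.prod_congr rfl fun p _ ↦ ?_
    rw [← lintegral_negExp_normSq_stdComplexGaussian (hw p), ← hlaw p,
      lintegral_map (hφ p) (hm p)]
  have hlim : Tendsto (fun s : Finset ι ↦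
      ∫⁻ ω, negExp (∑ p ∈ s, ENNReal.ofReal (w p * ‖H p ω‖ ^ 2)) ∂μ) atTop
      (𝓝 (∫⁻ ω, negExp (∑' p, ENNReal.ofReal (w p * ‖H p ω‖ ^ 2)) ∂μ)) := by
    refine tendsto_lintegral_filter_of_dominated_convergence (fun _ ↦ 1)
      (Eventually.of_forall fun s ↦ ?_) (Eventually.of_forall fun s ↦ ?_) (by simp) ?_
    · have := hm
      fun_prop
    · exact ae_of_all _ fun ω ↦ negExp_le_one _
    · exact ae_of_all _ fun ω ↦ (continuous_negExp.tendsto _).comp ENNReal.summable.hasSum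
  simp_rw [hfin] at hlim
  exact tendsto_nhds_unique hlim ((continuous_negExp.tendsto _).comp ENNReal.summable.hasSum)

lemma lintegral_mul_negExp_tsum_fading [IsProbabilityMeasure μ] {β ι : Type*} [MeasurableSpace β]
    [Countable ι] {T : Ω → β} {H : ι → Ω → ℂ} (hT : Measurable T) (hm : ∀ p, Measurable (H p))
    (hlaw : ∀ p, μ.map (H p) = stdComplexGaussian) (hind : iIndepFun H μ)
    (hTH : IndepFun T (fun ω p ↦ H p ω) μ) {Z : β → ℝ≥0∞} (hZ : Measurable Z) {w : ι → β → ℝ}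
    (hw : ∀ p, Measurable (w p)) (hw0 : ∀ p x, 0 ≤ w p x) :
    ∫⁻ ω, Z (T ω) * negExp (∑' p, ENNReal.ofReal (w p (T ω) * ‖H p ω‖ ^ 2)) ∂μ =
      ∫⁻ ω, Z (T ω) * negExp (∑' p, ENNReal.ofReal (Real.log (1 + w p (T ω)))) ∂μ := by
  have hHm : Measurable fun ω p ↦ H p ω := measurable_pi_lambda _ hm
  let Φ : β × (ι → ℂ) → ℝ≥0∞ := fun q ↦
    Z q.1 * negExp (∑' p, ENNReal.ofReal (w p q.1 * ‖q.2 p‖ ^ 2))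
  have hΦ : Measurable Φ := by
    refine (hZ.comp measurable_fst).mul (measurable_negExp.comp (Measurable.tsum fun p ↦ ?_))
    have : Measurable fun q : β × (ι → ℂ) ↦ w p q.1 := (hw p).comp measurable_fst
    fun_prop
  have hjoint := (indepFun_iff_map_prod_eq_prod_map_map hT.aemeasurable hHm.aemeasurable).1 hTH
  have := Measure.isProbabilityMeasure_map (μ := μ) hHm.aemeasurable
  calc ∫⁻ ω, Φ (T ω, fun p ↦ H p ω) ∂μ
    _ = ∫⁻ q, Φ q ∂(μ.map T).prod (μ.map fun ω p ↦ H p ω) := by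
        rw [← hjoint, lintegral_map hΦ (hT.prodMk hHm)]
    _ = ∫⁻ ω, ∫⁻ ω', Φ (T ω, fun p ↦ H p ω') ∂μ ∂μ := by
        rw [lintegral_prod _ hΦ.aemeasurable, lintegral_map hΦ.lintegral_prod_right' hT]
        exact lintegral_congr fun ω ↦ lintegral_map (hΦ.comp measurable_prodMk_left) hHm
    _ = ∫⁻ ω, Z (T ω) * negExp (∑' p, ENNReal.ofReal (Real.log (1 + w p (T ω)))) ∂μ := by
        refine lintegral_congr fun ω ↦ ?_
        simp only [Φ]
        rw [lintegral_const_mul _ (by fun_prop),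
          lintegral_negExp_tsum_fading hm hlaw hind fun p ↦ hw0 p (T ω)]

end Fading

/-- The superposition of the configurations `x i`, in which each point keeps the label `i` of the
configuration it belongs to. -/
def superposition {ι κ α : Type*} (x : ι → κ → α) (p : ι × κ) : ι × α := (p.1, x p.1 p.2)

section Superposition

lemma expFunctional_superposition {ι κ α : Type*} [Fintype ι] (g : ι × α → ℝ≥0∞)
    (x : ι → κ → α) :
    expFunctional g (superposition x) = ∏ i, expFunctional (fun y ↦ g (i, y)) (x i) := by
  simp only [expFunctional, superposition, ENNReal.tsum_prod', tsum_fintype, negExp_sum]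

lemma reducedExpFunctional_superposition {ι κ α : Type*} [Fintype ι] [DecidableEq ι]
    (g : ι × α → ℝ≥0∞) (x : ι → κ → α) (k : ι) (n : κ) :
    reducedExpFunctional g (superposition x) (k, n) =
      reducedExpFunctional (fun y ↦ g (k, y)) (x k) n *
        ∏ i ∈ Finset.univ.erase k, expFunctional (fun y ↦ g (i, y)) (x i) := by
  have hk : ∀ m, {p : ι × κ | p ≠ (k, n)}.indicator (fun p ↦ g (superposition x p)) (k, m) =
      {m | m ≠ n}.indicator (fun m ↦ g (k, x k m)) m := fun m ↦ by
    by_cases hm : m = n <;> simp [superposition, hm]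
  have hne : ∀ i ≠ k, ∀ m, {p : ι × κ | p ≠ (k, n)}.indicator
      (fun p ↦ g (superposition x p)) (i, m) = g (i, x i m) := fun i hi m ↦ by
    simp [superposition, hi]
  simp only [reducedExpFunctional, expFunctional, ← negExp_sum, ← negExp_add]
  congr 1
  calc ∑' p : {p // p ≠ (k, n)}, g (superposition x p)
    _ = ∑ i, ∑' m, {p : ι × κ | p ≠ (k, n)}.indicator (fun p ↦ g (superposition x p)) (i, m) := by
        rw [← tsum_fintype (L := .unconditional _), ← ENNReal.tsum_prod]
        exact tsum_subtype {p : ι × κ | p ≠ (k, n)} fun p ↦ g (superposition x p)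
    _ = ∑' m : {m // m ≠ n}, g (k, x k m) +
          ∑ i ∈ Finset.univ.erase k, ∑' m, g (i, x i m) := by
        rw [← Finset.add_sum_erase _ _ (Finset.mem_univ k)]
        congr 1
        · simp_rw [hk]
          exact (tsum_subtype {m | m ≠ n} fun m ↦ g (k, x k m)).symm
        · exact Finset.sum_congr rfl fun i hi ↦ tsum_congr (hne i (Finset.ne_of_mem_erase hi))

variable {ι Ω : Type*} [Fintype ι] [MeasurableSpace Ω] {μ : Measure Ω} {lam : ι → ℝ}
  {X : ι → ℕ → Ω → Plane}

lemma lintegral_prod_tier (hX : ∀ i, IsPoissonPointProcess μ (lam i) (X i))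
    (hind : iIndepFun (fun i ω n ↦ X i n ω) μ) {Y : ι → (ℕ → Plane) → ℝ≥0∞}
    (hY : ∀ i, Measurable (Y i)) :
    ∫⁻ ω, ∏ i, Y i (X i · ω) ∂μ = ∏ i, ∫⁻ ω, Y i (X i · ω) ∂μ :=
  lintegral_prod_eq_prod_lintegral_of_indepFun Finset.univ _ (hind.comp _ hY) fun i ↦
    (hY i).comp (measurable_pi_lambda _ (hX i).measurable)

variable [IsProbabilityMeasure μ]

lemma lintegral_expFunctional_superposition (hX : ∀ i, IsPoissonPointProcess μ (lam i) (X i))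
    (hind : iIndepFun (fun i ω n ↦ X i n ω) μ) {g : ι × Plane → ℝ≥0∞}
    (hg : ∀ i, Measurable fun y ↦ g (i, y)) :
    ∫⁻ ω, expFunctional g (superposition fun i n ↦ X i n ω) ∂μ =
      negExp (∑ i, poissonExponent (lam i) fun y ↦ g (i, y)) := by
  simp_rw [expFunctional_superposition, negExp_sum]
  rw [lintegral_prod_tier hX hind fun i ↦ measurable_expFunctional (hg i)]
  exact Finset.prod_congr rfl fun i _ ↦ (hX i).lintegral_expFunctional (hg i)

lemma lintegral_tsum_indicator_mul_reducedExpFunctional_superposition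
    (hX : ∀ i, IsPoissonPointProcess μ (lam i) (X i))
    (hind : iIndepFun (fun i ω n ↦ X i n ω) μ) {g : ι × Plane → ℝ≥0∞}
    (hg : ∀ i, Measurable fun y ↦ g (i, y)) {A : Set Plane} (hA : MeasurableSet A)
    (hb : Bornology.IsBounded A) (k : ι) :
    ∫⁻ ω, ∑' n, A.indicator (fun _ ↦ 1) (X k n ω) *
        reducedExpFunctional g (superposition fun i n ↦ X i n ω) (k, n) ∂μ =
      ENNReal.ofReal (lam k) * volume A *
        negExp (∑ i, poissonExponent (lam i) fun y ↦ g (i, y)) := by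
  classical
  let Y : ι → (ℕ → Plane) → ℝ≥0∞ := fun i x ↦ if i = k
    then ∑' n, A.indicator (fun _ ↦ 1) (x n) * reducedExpFunctional (fun y ↦ g (k, y)) x n
    else expFunctional (fun y ↦ g (i, y)) x
  have hYk : Y k = fun x ↦ ∑' n, A.indicator (fun _ ↦ 1) (x n) *
      reducedExpFunctional (fun y ↦ g (k, y)) x n := funext fun x ↦ if_pos rfl
  have hYne : ∀ i ∈ Finset.univ.erase k, Y i = expFunctional fun y ↦ g (i, y) :=
    fun i hi ↦ funext fun x ↦ if_neg (Finset.ne_of_mem_erase hi)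
  have hYm : ∀ i, Measurable (Y i) := fun i ↦ by
    by_cases hi : i = k
    · rw [hi, hYk]
      exact Measurable.tsum fun n ↦ ((measurable_const.indicator hA).comp
        (measurable_pi_apply n)).mul (measurable_reducedExpFunctional (hg k) n)
    · rw [hYne i (Finset.mem_erase.2 ⟨hi, Finset.mem_univ i⟩)]
      exact measurable_expFunctional (hg i)
  have hprod : ∀ x : ι → ℕ → Plane, ∑' n, A.indicator (fun _ ↦ 1) (x k n) *
      reducedExpFunctional g (superposition x) (k, n) = ∏ i, Y i (x i) := fun x ↦ by
    simp_rw [reducedExpFunctional_superposition, ← mul_assoc]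
    rw [ENNReal.tsum_mul_right, ← Finset.mul_prod_erase _ _ (Finset.mem_univ k), hYk,
      Finset.prod_congr rfl fun i hi ↦ congrFun (hYne i hi) (x i)]
  rw [lintegral_congr fun ω ↦ hprod fun i n ↦ X i n ω, lintegral_prod_tier hX hind hYm,
    ← Finset.mul_prod_erase _ _ (Finset.mem_univ k),
    ← Finset.add_sum_erase _ _ (Finset.mem_univ k), negExp_add, negExp_sum, ← mul_assoc, hYk,
    (hX k).lintegral_tsum_indicator_mul_reducedExpFunctional hA hb (hg k)]
  congr 1
  exact Finset.prod_congr rfl fun i hi ↦ by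
    rw [hYne i hi, (hX i).lintegral_expFunctional (hg i)]

end Superposition

/-- The cost of a BS of tier `q.1` at `q.2` when the user is served at squared distance `s`: BSs of
tier `i` up to the squared distance `κ i * s` are excluded, and those at its boundary interfere with
strength `θ i`. -/
noncomputable def tierCost {ι : Type*} (θ κ : ι → ℝ) (s : ℝ) (q : ι × Plane) : ℝ≥0∞ :=
  exclusionCost (θ q.1) (κ q.1 * s) (‖q.2‖ ^ 2)

section TierCost

variable {ι : Type*} {lam θ κ : ι → ℝ}

@[fun_prop]
lemma measurable_tierCost (θ κ : ι → ℝ) (s : ℝ) (i : ι) :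
    Measurable fun y ↦ tierCost θ κ s (i, y) :=
  (measurable_exclusionCost (θ i) (κ i * s)).comp (measurable_norm.pow_const 2)

lemma monotoneOn_tierCost (hθ : ∀ i, 0 ≤ θ i) (hκ : ∀ i, 0 ≤ κ i) :
    MonotoneOn (tierCost θ κ) (Set.Ici 0) := fun _ hs _ ht hst q ↦
  monotoneOn_exclusionCost (hθ q.1) (‖q.2‖ ^ 2) (mul_nonneg (hκ q.1) hs)
    (mul_nonneg (hκ q.1) ht) (mul_le_mul_of_nonneg_left hst (hκ q.1))

variable [Fintype ι]

lemma sum_poissonExponent_tierCost (hlam : ∀ i, 0 ≤ lam i) (hθ : ∀ i, 0 ≤ θ i)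
    (hκ : ∀ i, 0 ≤ κ i) {s : ℝ} (hs : 0 ≤ s) :
    ∑ i, poissonExponent (lam i) (fun y ↦ tierCost θ κ s (i, y)) =
      ENNReal.ofReal (Real.pi * (∑ i, lam i * κ i * loadFactor (θ i)) * s) := by
  have hnonneg : ∀ i, 0 ≤ lam i * Real.pi * (κ i * s * loadFactor (θ i)) := fun i ↦
    mul_nonneg (mul_nonneg (hlam i) Real.pi_nonneg)
      (mul_nonneg (mul_nonneg (hκ i) hs) (loadFactor_pos _).le)
  simp only [tierCost, poissonExponent_exclusionCost (hθ _) (mul_nonneg (hκ _) hs)]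
  rw [← ENNReal.ofReal_sum_of_nonneg fun i _ ↦ hnonneg i, Finset.mul_sum, Finset.sum_mul]
  congr 1
  exact Finset.sum_congr rfl fun i _ ↦ by ring

variable {Ω : Type*} [MeasurableSpace Ω] {μ : Measure Ω} [IsProbabilityMeasure μ]
  {X : ι → ℕ → Ω → Plane}

lemma hasShellIntegrals_tierCost (hX : ∀ i, IsPoissonPointProcess μ (lam i) (X i))
    (hind : iIndepFun (fun i ω n ↦ X i n ω) μ) (hlam : ∀ i, 0 ≤ lam i) (hθ : ∀ i, 0 ≤ θ i)
    (hκ : ∀ i, 0 ≤ κ i) (k : ι) :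
    HasShellIntegrals μ (fun n ω ↦ ‖X k n ω‖ ^ 2)
      (fun s n ω ↦ reducedExpFunctional (tierCost θ κ s) (superposition fun i n ↦ X i n ω) (k, n))
      (ENNReal.ofReal (lam k * Real.pi))
      (fun s ↦ negExp (ENNReal.ofReal (Real.pi * (∑ i, lam i * κ i * loadFactor (θ i)) * s))) where
  measurable_level n := ((hX k).measurable n).norm.pow_const 2
  level_nonneg n ω := by positivity
  measurable s n := measurable_negExp.comp <| Measurable.tsum fun p ↦
    (measurable_tierCost θ κ s p.1.1).comp ((hX p.1.1).measurable p.1.2)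
  antitoneOn n ω _ hs _ ht hst :=
    expFunctional_anti _ (monotoneOn_tierCost hθ hκ hs ht hst)
  lintegral_shell s u v hs hu _ := by
    have h := lintegral_tsum_indicator_mul_reducedExpFunctional_superposition hX hind
      (measurable_tierCost θ κ s) (measurableSet_normSq_mem_Ico u v)
      (isBounded_normSq_mem_Ico u v) k
    rw [sum_poissonExponent_tierCost hlam hθ hκ hs, volume_normSq_mem_Ico, ← mul_assoc,
      ← ENNReal.ofReal_mul (hlam k), ← ENNReal.ofReal_sub _ hu] at h
    exact h

lemma lintegral_negExp_mul_Ioi {c r : ℝ} (hc : 0 ≤ c) (hr : 0 < r) :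
    ∫⁻ s in Set.Ioi 0, ENNReal.ofReal c * negExp (ENNReal.ofReal (r * s)) =
      ENNReal.ofReal (c / r) := by
  have hexp : ∀ s ∈ Set.Ioi (0 : ℝ),
      negExp (ENNReal.ofReal (r * s)) = ENNReal.ofReal (Real.exp (-r * s)) := fun s hs ↦ by
    rw [negExp_ofReal (mul_nonneg hr.le (Set.mem_Ioi.1 hs).le), neg_mul]
  rw [lintegral_const_mul _ (by fun_prop), setLIntegral_congr_fun measurableSet_Ioi hexp,
    ← ofReal_integral_eq_lintegral_ofReal (integrableOn_exp_mul_Ioi (neg_neg_of_pos hr) 0)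
      (ae_of_all _ fun _ ↦ (Real.exp_pos _).le),
    integral_exp_mul_Ioi (neg_neg_of_pos hr), ← ENNReal.ofReal_mul hc]
  simp [div_eq_mul_inv]

lemma lintegral_tsum_reducedExpFunctional_tierCost
    (hX : ∀ i, IsPoissonPointProcess μ (lam i) (X i))
    (hind : iIndepFun (fun i ω n ↦ X i n ω) μ) (hlam : ∀ i, 0 ≤ lam i) (hθ : ∀ i, 0 ≤ θ i)
    (hκ : ∀ i, 0 ≤ κ i) (hload : 0 < ∑ i, lam i * κ i * loadFactor (θ i)) (k : ι) :
    ∫⁻ ω, ∑' n, reducedExpFunctional (tierCost θ κ (‖X k n ω‖ ^ 2))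
        (superposition fun i n ↦ X i n ω) (k, n) ∂μ =
      ENNReal.ofReal (lam k / ∑ i, lam i * κ i * loadFactor (θ i)) := by
  have hpi := Real.pi_pos
  rw [(hasShellIntegrals_tierCost hX hind hlam hθ hκ k).lintegral_tsum ENNReal.ofReal_ne_top
      (fun s _ t _ hst ↦ negExp_antitone (ENNReal.ofReal_le_ofReal (by gcongr)))
      ((negExp_le_one _).trans_lt ENNReal.one_lt_top).ne,
    lintegral_negExp_mul_Ioi (mul_nonneg (hlam k) hpi.le) (by positivity)]
  congr 1
  field_simp

end TierCost

section NearestPoint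

variable {Ω : Type*} [MeasurableSpace Ω] {μ : Measure Ω} [IsProbabilityMeasure μ] {lam : ℝ}
  {X : ℕ → Ω → Plane}

lemma tsum_le_one_of_forall_ne_zero_lt {ι : Type*} {f : ι → ℝ≥0∞} {r : ι → ℝ} (hf : ∀ n, f n ≤ 1)
    (hr : ∀ n, f n ≠ 0 → ∀ m ≠ n, r n < r m) : ∑' n, f n ≤ 1 := by
  by_cases hex : ∃ n, f n ≠ 0
  · obtain ⟨n, hn⟩ := hex
    rw [tsum_eq_single n fun m hm ↦ of_not_not fun hfm ↦
      (hr n hn m hm).asymm (hr m hfm n hm.symm)]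
    exact hf n
  · simp [not_exists_not.1 hex]

lemma IsPoissonPointProcess.ae_exists_forall_norm_lt (hX : IsPoissonPointProcess μ lam X)
    (hlam : 0 < lam) : ∀ᵐ ω ∂μ, ∃ n, ∀ m ≠ n, ‖X n ω‖ < ‖X m ω‖ := by
  let f : Ω → ℕ → ℝ≥0∞ := fun ω n ↦ reducedExpFunctional (tierCost 0 1 (‖X n ω‖ ^ 2))
    (superposition fun (_ : Unit) n ↦ X n ω) ((), n)
  have hlt : ∀ ω n, f ω n ≠ 0 → ∀ m ≠ n, ‖X n ω‖ < ‖X m ω‖ := fun ω n hn m hm ↦ by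
    by_contra! hle
    refine hn (reducedExpFunctional_eq_zero (m := ((), m)) (by simpa using hm)
      (exclusionCost_eq_top ?_))
    simpa [superposition] using pow_le_pow_left₀ (norm_nonneg _) hle 2
  have hint : ∫⁻ ω, ∑' n, f ω n ∂μ = 1 := by
    have h := lintegral_tsum_reducedExpFunctional_tierCost (ι := Unit) (θ := 0) (κ := 1)
      (fun _ ↦ hX) iIndepFun.of_subsingleton (fun _ ↦ hlam.le) (fun _ ↦ le_rfl)
      (fun _ ↦ zero_le_one) (by simpa [loadFactor_zero] using hlam) ()
    simpa [f, loadFactor_zero, div_self hlam.ne'] using h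
  have hle : ∀ ω, ∑' n, f ω n ≤ 1 := fun ω ↦
    tsum_le_one_of_forall_ne_zero_lt (fun n ↦ expFunctional_le_one _ _) (hlt ω)
  have hone : ∀ᵐ ω ∂μ, ∑' n, f ω n = 1 := ae_eq_of_ae_le_of_lintegral_le (ae_of_all _ hle)
    (by simp [hint]) aemeasurable_const (by simp [hint])
  filter_upwards [hone] with ω hω
  obtain ⟨n, hn⟩ : ∃ n, f ω n ≠ 0 := by
    by_contra! hzero
    simp [hzero] at hω
  exact ⟨n, hlt ω n hn⟩

lemma IsPoissonPointProcess.ae_forall_norm_pos (hX : IsPoissonPointProcess μ lam X) :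
    ∀ᵐ ω ∂μ, ∀ n, 0 < ‖X n ω‖ := by
  filter_upwards [hX.ae_forall_notMem (measurableSet_singleton 0) Bornology.isBounded_singleton
    (measure_singleton 0)] with ω hω n
  exact norm_pos_iff.2 (hω n)

end NearestPoint

/-- The ratio between the squared distances at which tiers `i` and `k` are equally attractive. -/
noncomputable def sqDistRatio {K : ℕ} (P B : Fin K → ℝ) (k i : Fin K) : ℝ :=
  √(B i * P i / (B k * P k))

section Association

variable {Ω : Type*} {K : ℕ} {P B : Fin K → ℝ} {X : Fin K → ℕ → Ω → Plane} {h : Fin K → ℕ → Ω → ℂ}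
  {ω : Ω} {k : Fin K}

lemma sqDistRatio_pos (hP : ∀ i, 0 < P i) (hB : ∀ i, 0 < B i) (k i : Fin K) :
    0 < sqDistRatio P B k i :=
  Real.sqrt_pos.2 (div_pos (mul_pos (hB i) (hP i)) (mul_pos (hB k) (hP k)))

lemma sqDistRatio_self (hP : ∀ i, 0 < P i) (hB : ∀ i, 0 < B i) (k : Fin K) :
    sqDistRatio P B k k = 1 := by
  rw [sqDistRatio, div_self (mul_pos (hB k) (hP k)).ne', Real.sqrt_one]

lemma sqDistRatio_eq_div (hP : ∀ i, 0 < P i) (hB : ∀ i, 0 < B i) (k i : Fin K) :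
    sqDistRatio P B k i = √(B i * P i) / √(B k * P k) :=
  Real.sqrt_div (mul_pos (hB i) (hP i)).le _

lemma biased_power_lt_iff (hP : ∀ i, 0 < P i) (hB : ∀ i, 0 < B i) (k i : Fin K) {r t : ℝ}
    (hr : 0 < r) (ht : 0 < t) :
    B i * P i / t ^ 4 < B k * P k / r ^ 4 ↔ sqDistRatio P B k i * r ^ 2 < t ^ 2 := by
  have hk : 0 < B k * P k := mul_pos (hB k) (hP k)
  have hi : 0 < B i * P i := mul_pos (hB i) (hP i)
  rw [← pow_lt_pow_iff_left₀ (mul_pos (sqDistRatio_pos hP hB k i) (by positivity)).le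
    (by positivity) two_ne_zero, mul_pow, sqDistRatio, Real.sq_sqrt (by positivity),
    div_lt_div_iff₀ (by positivity) (by positivity), div_mul_eq_mul_div, div_lt_iff₀ hk]
  ring_nf

lemma tierCost_sqDistRatio (hP : ∀ i, 0 < P i) (hB : ∀ i, 0 < B i) (a : ℝ) {i : Fin K} {s : ℝ}
    {y : Plane} (hy : sqDistRatio P B k i * s < ‖y‖ ^ 2) :
    tierCost (fun i ↦ a * B k / B i) (sqDistRatio P B k) s (i, y) =
      ENNReal.ofReal (Real.log (1 + a * s ^ 2 / P k * (P i / ‖y‖ ^ 4))) := by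
  have hPi := hP i
  have hPk := hP k
  have hBi := hB i
  have hBk := hB k
  rw [tierCost, exclusionCost_of_lt hy, div_pow, mul_pow, sqDistRatio,
    Real.sq_sqrt (by positivity)]
  congr 3
  field_simp

lemma nearestDist_nonneg (X : Fin K → ℕ → Ω → Plane) (i : Fin K) (ω : Ω) :
    0 ≤ nearestDist X i ω :=
  Real.iInf_nonneg fun _ ↦ norm_nonneg _

lemma le_of_forall_ne_lt {ι β : Type*} [Preorder β] {r : ι → β} {n : ι}
    (hn : ∀ m ≠ n, r n < r m) (m : ι) : r n ≤ r m := by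
  by_cases hm : m = n
  · rw [hm]
  · exact (hn m hm).le

lemma nearestDist_eq {i : Fin K} {n : ℕ} (hn : ∀ m ≠ n, ‖X i n ω‖ < ‖X i m ω‖) :
    nearestDist X i ω = ‖X i n ω‖ :=
  le_antisymm (ciInf_le ⟨0, Set.forall_mem_range.2 fun _ ↦ norm_nonneg _⟩ n)
    (le_ciInf (le_of_forall_ne_lt (r := fun m ↦ ‖X i m ω‖) hn))

lemma mem_assocEvent_iff (hP : ∀ i, 0 < P i) (hB : ∀ i, 0 < B i) {N : Fin K → ℕ}
    (hN : ∀ i, ∀ m ≠ N i, ‖X i (N i) ω‖ < ‖X i m ω‖) (hpos : ∀ i n, 0 < ‖X i n ω‖) :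
    ω ∈ assocEvent P B X k ↔
      ∀ i ≠ k, sqDistRatio P B k i * ‖X k (N k) ω‖ ^ 2 < ‖X i (N i) ω‖ ^ 2 := by
  simp only [assocEvent, Set.mem_ofPred_eq, nearestDist_eq (hN _)]
  exact forall₂_congr fun i _ ↦ biased_power_lt_iff hP hB k i (hpos _ _) (hpos _ _)

lemma interferenceTerm_eq_zero {n : ℕ} (hn : ∀ m ≠ n, ‖X k n ω‖ < ‖X k m ω‖) :
    interferenceTerm P X h k ω (k, n) = 0 :=
  if_pos ⟨rfl, (nearestDist_eq hn).symm⟩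

lemma interferenceTerm_of_ne {n : ℕ} (hn : ∀ m ≠ n, ‖X k n ω‖ < ‖X k m ω‖) {p : Fin K × ℕ}
    (hp : p ≠ (k, n)) :
    interferenceTerm P X h k ω p = P p.1 * ‖h p.1 p.2 ω‖ ^ 2 / ‖X p.1 p.2 ω‖ ^ 4 := by
  refine if_neg fun ⟨hk, hdist⟩ ↦ hp ?_
  obtain ⟨i, m⟩ := p
  obtain rfl : i = k := hk
  by_contra hm
  exact (hn m fun hmn ↦ hm (by rw [hmn])).ne' (hdist.trans (nearestDist_eq hn))

lemma interferenceTerm_eq_mul (p : Fin K × ℕ) :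
    interferenceTerm P X h k ω p =
      interferenceTerm P X (fun _ _ _ ↦ 1) k ω p * ‖h p.1 p.2 ω‖ ^ 2 := by
  unfold interferenceTerm
  split_ifs
  · simp
  · simp [mul_div_right_comm]

lemma interferenceTerm_nonneg (hP : ∀ i, 0 ≤ P i) (k : Fin K) (ω : Ω) (p : Fin K × ℕ) :
    0 ≤ interferenceTerm P X h k ω p := by
  have := hP p.1
  unfold interferenceTerm
  split_ifs <;> positivity

lemma interferenceTerm_le (hP : ∀ i, 0 ≤ P i) (k : Fin K) (ω : Ω) (p : Fin K × ℕ) :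
    interferenceTerm P X h k ω p ≤ P p.1 * ‖h p.1 p.2 ω‖ ^ 2 / ‖X p.1 p.2 ω‖ ^ 4 := by
  have := hP p.1
  unfold interferenceTerm
  split_ifs
  · positivity
  · rfl

lemma reducedExpFunctional_tierCost_eq_negExp (hP : ∀ i, 0 < P i) (hB : ∀ i, 0 < B i) (a : ℝ)
    {n : ℕ} (hn : ∀ m ≠ n, ‖X k n ω‖ < ‖X k m ω‖)
    (hexcl : ∀ i ≠ k, ∀ m, sqDistRatio P B k i * ‖X k n ω‖ ^ 2 < ‖X i m ω‖ ^ 2) :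
    reducedExpFunctional (tierCost (fun i ↦ a * B k / B i) (sqDistRatio P B k) (‖X k n ω‖ ^ 2))
        (superposition fun i n ↦ X i n ω) (k, n) =
      negExp (∑' p, ENNReal.ofReal (Real.log (1 + a * nearestDist X k ω ^ 4 / P k *
        interferenceTerm P X (fun _ _ _ ↦ 1) k ω p))) := by
  have hfar : ∀ p : Fin K × ℕ, p ≠ (k, n) →
      sqDistRatio P B k p.1 * ‖X k n ω‖ ^ 2 < ‖X p.1 p.2 ω‖ ^ 2 := by
    rintro ⟨i, m⟩ hp
    by_cases hi : i = k
    · subst hi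
      rw [sqDistRatio_self hP hB, one_mul]
      exact pow_lt_pow_left₀ (hn m fun hm ↦ hp (by rw [hm])) (norm_nonneg _) two_ne_zero
    · exact hexcl i hi m
  rw [tsum_eq_add_tsum_ne _ (k, n), interferenceTerm_eq_zero hn, reducedExpFunctional,
    expFunctional]
  simp only [mul_zero, add_zero, Real.log_one, ENNReal.ofReal_zero, zero_add]
  refine congrArg negExp (tsum_congr fun p ↦ ?_)
  rw [interferenceTerm_of_ne hn p.2, nearestDist_eq hn, superposition,
    tierCost_sqDistRatio hP hB a (hfar p p.2)]
  simp [← pow_mul]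

lemma indicator_assocEvent_mul_negExp (hP : ∀ i, 0 < P i) (hB : ∀ i, 0 < B i) (a : ℝ)
    (hnear : ∀ i, ∃ n, ∀ m ≠ n, ‖X i n ω‖ < ‖X i m ω‖) (hpos : ∀ i n, 0 < ‖X i n ω‖) :
    (assocEvent P B X k).indicator (fun _ ↦ 1) ω *
        negExp (∑' p, ENNReal.ofReal (Real.log (1 + a * nearestDist X k ω ^ 4 / P k *
          interferenceTerm P X (fun _ _ _ ↦ 1) k ω p))) =
      ∑' n, reducedExpFunctional
        (tierCost (fun i ↦ a * B k / B i) (sqDistRatio P B k) (‖X k n ω‖ ^ 2))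
        (superposition fun i n ↦ X i n ω) (k, n) := by
  choose N hN using hnear
  have hother : ∀ n ≠ N k, reducedExpFunctional
      (tierCost (fun i ↦ a * B k / B i) (sqDistRatio P B k) (‖X k n ω‖ ^ 2))
      (superposition fun i n ↦ X i n ω) (k, n) = 0 := fun n hn ↦ by
    refine reducedExpFunctional_eq_zero (m := (k, N k)) (by simpa using hn.symm)
      (exclusionCost_eq_top ?_)
    simpa [superposition, sqDistRatio_self hP hB] using
      pow_le_pow_left₀ (norm_nonneg _) (hN k n hn).le 2
  rw [tsum_eq_single (N k) hother]
  by_cases hω : ω ∈ assocEvent P B X k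
  · rw [Set.indicator_of_mem hω, one_mul, reducedExpFunctional_tierCost_eq_negExp hP hB a (hN k)]
    exact fun i hi m ↦ ((mem_assocEvent_iff hP hB hN hpos).1 hω i hi).trans_le
      (pow_le_pow_left₀ (norm_nonneg _)
        (le_of_forall_ne_lt (r := fun m ↦ ‖X i m ω‖) (hN i) m) 2)
  · rw [Set.indicator_of_notMem hω, zero_mul]
    simp only [mem_assocEvent_iff hP hB hN hpos, not_forall, not_lt] at hω
    obtain ⟨i, hi, hle⟩ := hω
    symm
    refine reducedExpFunctional_eq_zero (m := (i, N i)) (fun heq ↦ hi (congrArg Prod.fst heq)) ?_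
    exact exclusionCost_eq_top hle

end Association

section Network

variable {Ω : Type*} [MeasurableSpace Ω] {μ : Measure Ω} {K : ℕ} {lam P B : Fin K → ℝ}
  {X : Fin K → ℕ → Ω → Plane} {h : Fin K → ℕ → Ω → ℂ}

lemma IsNetwork.measurable_location (hnet : IsNetwork μ lam X h) (i : Fin K) (n : ℕ) :
    Measurable (X i n) :=
  (hnet.tier_poisson i).measurable n

lemma lintegral_negExp_mul_le {Y : Ω → ℝ≥0∞} (hY : Measurable Y) {c : ℝ≥0∞} (hc : c ≠ 0) :
    ∫⁻ ω, negExp (c * Y ω) ∂μ ≤ μ {ω | Y ω ≠ ⊤} := by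
  have hfin : MeasurableSet {ω | Y ω ≠ ⊤} := (hY (measurableSet_singleton ⊤)).compl
  rw [← lintegral_indicator_one hfin]
  refine lintegral_mono fun ω ↦ ?_
  by_cases hω : Y ω = ⊤
  · simp [hω, ENNReal.mul_top hc]
  · simpa [hω] using negExp_le_one _

lemma ofReal_log_le_tierCost (hP : ∀ i, 0 ≤ P i) (s : ℝ) (i : Fin K) (y : Plane) :
    ENNReal.ofReal (Real.log (1 + s ^ 2 * (P i / ‖y‖ ^ 4))) ≤
      tierCost 1 (fun i ↦ √(P i)) s (i, y) := by
  rw [tierCost]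
  obtain hle | hlt := le_or_gt (‖y‖ ^ 2) (√(P i) * s)
  · exact (exclusionCost_eq_top hle).symm ▸ le_top
  · rw [exclusionCost_of_lt hlt, div_pow, mul_pow, Real.sq_sqrt (hP i), ← pow_mul, Pi.one_apply,
      one_mul, mul_div_assoc', mul_comm (s ^ 2)]

variable [IsProbabilityMeasure μ]

lemma IsNetwork.lintegral_mul_negExp_tsum_fading (hnet : IsNetwork μ lam X h)
    {Z : (Fin K → ℕ → Plane) → ℝ≥0∞} (hZ : Measurable Z)
    {w : Fin K × ℕ → (Fin K → ℕ → Plane) → ℝ} (hw : ∀ p, Measurable (w p))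
    (hw0 : ∀ p x, 0 ≤ w p x) :
    ∫⁻ ω, Z (fun i n ↦ X i n ω) * negExp (∑' p : Fin K × ℕ,
        ENNReal.ofReal (w p (fun i n ↦ X i n ω) * ‖h p.1 p.2 ω‖ ^ 2)) ∂μ =
      ∫⁻ ω, Z (fun i n ↦ X i n ω) * negExp (∑' p : Fin K × ℕ,
        ENNReal.ofReal (Real.log (1 + w p (fun i n ↦ X i n ω)))) ∂μ := by
  have hT : Measurable fun ω i n ↦ X i n ω :=
    measurable_pi_lambda _ fun i ↦ measurable_pi_lambda _ fun n ↦ hnet.measurable_location i n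
  have hflat : Measurable fun (x : Fin K → ℕ → ℂ) (p : Fin K × ℕ) ↦ x p.1 p.2 := by fun_prop
  exact MultiTier.lintegral_mul_negExp_tsum_fading (H := fun p : Fin K × ℕ ↦ h p.1 p.2) hT
    (fun p ↦ hnet.fading_measurable p.1 p.2) (fun p ↦ hnet.fading_law p.1 p.2)
    hnet.fading_indep (hnet.fading_indep_location.comp measurable_id hflat) hZ hw hw0

lemma IsNetwork.negExp_le_measure_power_ne_top (hnet : IsNetwork μ lam X h)
    (hlam : ∀ i, 0 ≤ lam i) (hP : ∀ i, 0 ≤ P i) {s : ℝ} (hs : 0 < s) :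
    negExp (ENNReal.ofReal (Real.pi * (∑ i, lam i * √(P i) * loadFactor 1) * s)) ≤
      μ {ω | ∑' p : Fin K × ℕ,
        ENNReal.ofReal (P p.1 * ‖h p.1 p.2 ω‖ ^ 2 / ‖X p.1 p.2 ω‖ ^ 4) ≠ ⊤} := by
  have hX := hnet.measurable_location
  have hh := hnet.fading_measurable
  have hscale : ∀ ω (p : Fin K × ℕ), ENNReal.ofReal (s ^ 2) *
      ENNReal.ofReal (P p.1 * ‖h p.1 p.2 ω‖ ^ 2 / ‖X p.1 p.2 ω‖ ^ 4) =
      ENNReal.ofReal (s ^ 2 * (P p.1 / ‖X p.1 p.2 ω‖ ^ 4) * ‖h p.1 p.2 ω‖ ^ 2) := fun ω p ↦ by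
    rw [← ENNReal.ofReal_mul (sq_nonneg s)]
    ring_nf
  have hnonneg : ∀ (p : Fin K × ℕ) (x : Fin K → ℕ → Plane),
      0 ≤ s ^ 2 * (P p.1 / ‖x p.1 p.2‖ ^ 4) := fun p x ↦
    mul_nonneg (sq_nonneg s) (div_nonneg (hP p.1) (by positivity))
  calc negExp (ENNReal.ofReal (Real.pi * (∑ i, lam i * √(P i) * loadFactor 1) * s))
      = ∫⁻ ω, expFunctional (tierCost 1 (fun i ↦ √(P i)) s)
          (superposition fun i n ↦ X i n ω) ∂μ := by
        rw [lintegral_expFunctional_superposition hnet.tier_poisson hnet.tier_indep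
          (measurable_tierCost _ _ s),
          sum_poissonExponent_tierCost (θ := 1) hlam (fun _ ↦ zero_le_one)
            (fun i ↦ Real.sqrt_nonneg _) hs.le]
        rfl
    _ ≤ ∫⁻ ω, negExp (∑' p : Fin K × ℕ, ENNReal.ofReal
          (Real.log (1 + s ^ 2 * (P p.1 / ‖X p.1 p.2 ω‖ ^ 4)))) ∂μ :=
        lintegral_mono fun ω ↦ negExp_antitone <| ENNReal.tsum_le_tsum fun p ↦
          ofReal_log_le_tierCost hP s p.1 (X p.1 p.2 ω)
    _ = ∫⁻ ω, negExp (ENNReal.ofReal (s ^ 2) * ∑' p : Fin K × ℕ,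
          ENNReal.ofReal (P p.1 * ‖h p.1 p.2 ω‖ ^ 2 / ‖X p.1 p.2 ω‖ ^ 4)) ∂μ := by
        simp_rw [← ENNReal.tsum_mul_left, hscale]
        simpa using (hnet.lintegral_mul_negExp_tsum_fading measurable_one
          (fun p ↦ by fun_prop) hnonneg).symm
    _ ≤ _ := lintegral_negExp_mul_le (Measurable.tsum fun p ↦ by fun_prop)
        (by simpa using hs.ne')

lemma IsNetwork.ae_summable_power (hnet : IsNetwork μ lam X h) (hlam : ∀ i, 0 ≤ lam i)
    (hP : ∀ i, 0 ≤ P i) :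
    ∀ᵐ ω ∂μ, Summable fun p : Fin K × ℕ ↦ P p.1 * ‖h p.1 p.2 ω‖ ^ 2 / ‖X p.1 p.2 ω‖ ^ 4 := by
  have hX := hnet.measurable_location
  have hh := hnet.fading_measurable
  have hlim : Tendsto (fun s ↦ negExp (ENNReal.ofReal
      (Real.pi * (∑ i, lam i * √(P i) * loadFactor 1) * s))) (𝓝[>] 0) (𝓝 1) := by
    have hcont := continuous_negExp.comp (ENNReal.continuous_ofReal.comp
      (continuous_const_mul (Real.pi * ∑ i, lam i * √(P i) * loadFactor 1)))
    simpa [Function.comp_def] using (hcont.tendsto 0).mono_left nhdsWithin_le_nhds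
  have hone := le_of_tendsto hlim <| eventually_mem_nhdsWithin.mono fun s hs ↦
    hnet.negExp_le_measure_power_ne_top hlam hP hs
  have hfin : ∀ᵐ ω ∂μ, ∑' p : Fin K × ℕ,
      ENNReal.ofReal (P p.1 * ‖h p.1 p.2 ω‖ ^ 2 / ‖X p.1 p.2 ω‖ ^ 4) ≠ ⊤ :=
    (mem_ae_iff_prob_eq_one (MeasurableSet.compl
      ((Measurable.tsum fun p ↦ by fun_prop) (measurableSet_singleton ⊤)))).2
      (le_antisymm prob_le_one hone)
  filter_upwards [hfin] with ω hω
  refine (ENNReal.summable_toReal hω).congr fun p ↦ ENNReal.toReal_ofReal ?_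
  exact div_nonneg (mul_nonneg (hP p.1) (sq_nonneg _)) (by positivity)

lemma IsNetwork.ae_summable_interferenceTerm (hnet : IsNetwork μ lam X h)
    (hlam : ∀ i, 0 ≤ lam i) (hP : ∀ i, 0 ≤ P i) (k : Fin K) :
    ∀ᵐ ω ∂μ, Summable (interferenceTerm P X h k ω) := by
  filter_upwards [hnet.ae_summable_power hlam hP] with ω hω
  exact hω.of_nonneg_of_le (interferenceTerm_nonneg hP k ω) (interferenceTerm_le hP k ω)

end Network

section LaplaceTransform

variable {Ω : Type*} {K : ℕ} {lam P B : Fin K → ℝ} {X : Fin K → ℕ → Ω → Plane}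
  {h : Fin K → ℕ → Ω → ℂ} {a : ℝ}

/-- The integrand `exp (-z I)` of `tierLT`, as an extended nonnegative number; it vanishes where the
interference is infinite. -/
noncomputable def expInterference (P : Fin K → ℝ) (X : Fin K → ℕ → Ω → Plane)
    (h : Fin K → ℕ → Ω → ℂ) (a : ℝ) (k : Fin K) (ω : Ω) : ℝ≥0∞ :=
  negExp (∑' p, ENNReal.ofReal (a * nearestDist X k ω ^ 4 / P k * interferenceTerm P X h k ω p))

lemma normalization_nonneg (hP : ∀ i, 0 ≤ P i) (ha : 0 ≤ a) (k : Fin K) (ω : Ω) :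
    0 ≤ a * nearestDist X k ω ^ 4 / P k :=
  div_nonneg (mul_nonneg ha (pow_nonneg (nearestDist_nonneg X k ω) 4)) (hP k)

lemma toReal_expInterference (hP : ∀ i, 0 ≤ P i) (ha : 0 ≤ a) {k : Fin K} {ω : Ω}
    (hω : Summable (interferenceTerm P X h k ω)) :
    (expInterference P X h a k ω).toReal =
      Real.exp (-(a * nearestDist X k ω ^ 4 / P k * interference P X h k ω)) := by
  have hc := normalization_nonneg (X := X) hP ha k ω
  have hn := interferenceTerm_nonneg (X := X) (h := h) hP k ω
  rw [expInterference, ← ENNReal.ofReal_tsum_of_nonneg (fun p ↦ mul_nonneg hc (hn p))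
    (hω.mul_left _), tsum_mul_left, negExp_ofReal (mul_nonneg hc (tsum_nonneg hn)),
    ENNReal.toReal_ofReal (Real.exp_pos _).le, interference]

variable [MeasurableSpace Ω]

@[fun_prop]
lemma measurable_nearestDist (hX : ∀ i n, Measurable (X i n)) (i : Fin K) :
    Measurable (nearestDist X i) :=
  Measurable.iInf fun n ↦ (hX i n).norm

lemma measurableSet_assocEvent (hX : ∀ i n, Measurable (X i n)) (k : Fin K) :
    MeasurableSet (assocEvent P B X k) := by
  simp only [assocEvent, Set.ofPred_forall]
  exact MeasurableSet.iInter fun i ↦ MeasurableSet.iInter fun _ ↦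
    measurableSet_lt (by fun_prop) (by fun_prop)

lemma measurable_interferenceTerm (hX : ∀ i n, Measurable (X i n)) (hh : ∀ i n, Measurable (h i n))
    (k : Fin K) (p : Fin K × ℕ) : Measurable fun ω ↦ interferenceTerm P X h k ω p :=
  Measurable.ite ((MeasurableSet.const _).inter
    (measurableSet_eq_fun (hX p.1 p.2).norm (measurable_nearestDist hX k)))
    measurable_const (by fun_prop)

lemma measurable_expInterference (hX : ∀ i n, Measurable (X i n)) (hh : ∀ i n, Measurable (h i n))
    (a : ℝ) (k : Fin K) : Measurable (expInterference P X h a k) := by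
  refine measurable_negExp.comp (Measurable.tsum fun p ↦ ?_)
  have := measurable_interferenceTerm (P := P) hX hh k p
  fun_prop

variable {μ : Measure Ω} [IsProbabilityMeasure μ]

lemma IsNetwork.ae_eq_sum_reducedExpFunctional (hnet : IsNetwork μ lam X h)
    (hlam : ∀ i, 0 < lam i) (hP : ∀ i, 0 < P i) (hB : ∀ i, 0 < B i) (a : ℝ) (k : Fin K) :
    ∀ᵐ ω ∂μ, (assocEvent P B X k).indicator (fun _ ↦ 1) ω *
        negExp (∑' p, ENNReal.ofReal (Real.log (1 + a * nearestDist X k ω ^ 4 / P k *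
          interferenceTerm P X (fun _ _ _ ↦ 1) k ω p))) =
      ∑' n, reducedExpFunctional
        (tierCost (fun i ↦ a * B k / B i) (sqDistRatio P B k) (‖X k n ω‖ ^ 2))
        (superposition fun i n ↦ X i n ω) (k, n) := by
  have hnear : ∀ᵐ ω ∂μ, ∀ i, ∃ n, ∀ m ≠ n, ‖X i n ω‖ < ‖X i m ω‖ :=
    ae_all_iff.2 fun i ↦ (hnet.tier_poisson i).ae_exists_forall_norm_lt (hlam i)
  have hpos : ∀ᵐ ω ∂μ, ∀ i n, 0 < ‖X i n ω‖ :=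
    ae_all_iff.2 fun i ↦ (hnet.tier_poisson i).ae_forall_norm_pos
  filter_upwards [hnear, hpos] with ω hω hω'
  exact indicator_assocEvent_mul_negExp hP hB a hω hω'

lemma IsNetwork.lintegral_indicator_assocEvent_mul_expInterference (hnet : IsNetwork μ lam X h)
    (hP : ∀ i, 0 ≤ P i) (ha : 0 ≤ a) (k : Fin K) :
    ∫⁻ ω, (assocEvent P B X k).indicator (fun _ ↦ 1) ω * expInterference P X h a k ω ∂μ =
      ∫⁻ ω, (assocEvent P B X k).indicator (fun _ ↦ 1) ω *
        negExp (∑' p, ENNReal.ofReal (Real.log (1 + a * nearestDist X k ω ^ 4 / P k *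
          interferenceTerm P X (fun _ _ _ ↦ 1) k ω p))) ∂μ := by
  let loc : Fin K → ℕ → (Fin K → ℕ → Plane) → Plane := fun i n x ↦ x i n
  have hloc : ∀ i n, Measurable (loc i n) := fun i n ↦ by fun_prop
  have hw : ∀ p, Measurable fun x ↦ a * nearestDist loc k x ^ 4 / P k *
      interferenceTerm P loc (fun _ _ _ ↦ 1) k x p := fun p ↦ by
    have := measurable_interferenceTerm (P := P) hloc
      (fun _ _ ↦ measurable_const (a := (1 : ℂ))) k p
    fun_prop
  have hw0 : ∀ p x, 0 ≤ a * nearestDist loc k x ^ 4 / P k *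
      interferenceTerm P loc (fun _ _ _ ↦ 1) k x p := fun p x ↦
    mul_nonneg (normalization_nonneg hP ha k x) (interferenceTerm_nonneg hP k x p)
  have hZ : Measurable ((assocEvent P B loc k).indicator (1 : (Fin K → ℕ → Plane) → ℝ≥0∞)) :=
    measurable_one.indicator (measurableSet_assocEvent hloc k)
  have hfading := hnet.lintegral_mul_negExp_tsum_fading hZ hw hw0
  simp_rw [expInterference, interferenceTerm_eq_mul (h := h), ← mul_assoc]
  exact hfading

lemma IsNetwork.setLIntegral_expInterference (hnet : IsNetwork μ lam X h)
    (hlam : ∀ i, 0 < lam i) (hP : ∀ i, 0 < P i) (hB : ∀ i, 0 < B i) (ha : 0 ≤ a) (k : Fin K) :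
    ∫⁻ ω in assocEvent P B X k, expInterference P X h a k ω ∂μ =
      ENNReal.ofReal
        (lam k / ∑ i, lam i * sqDistRatio P B k i * loadFactor (a * B k / B i)) := by
  have hload : 0 < ∑ i, lam i * sqDistRatio P B k i * loadFactor (a * B k / B i) :=
    Finset.sum_pos (fun i _ ↦ mul_pos (mul_pos (hlam i) (sqDistRatio_pos hP hB k i))
      (loadFactor_pos _)) ⟨k, Finset.mem_univ k⟩
  have hA : MeasurableSet (assocEvent P B X k) :=
    measurableSet_assocEvent hnet.measurable_location k
  calc ∫⁻ ω in assocEvent P B X k, expInterference P X h a k ω ∂μ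
      = ∫⁻ ω, (assocEvent P B X k).indicator (fun _ ↦ 1) ω * expInterference P X h a k ω ∂μ := by
        simp_rw [← Set.indicator_mul_left, one_mul]
        exact (lintegral_indicator hA _).symm
    _ = _ := hnet.lintegral_indicator_assocEvent_mul_expInterference (fun i ↦ (hP i).le) ha k
    _ = _ := lintegral_congr_ae (hnet.ae_eq_sum_reducedExpFunctional hlam hP hB a k)
    _ = _ := lintegral_tsum_reducedExpFunctional_tierCost hnet.tier_poisson hnet.tier_indep
        (fun i ↦ (hlam i).le) (fun i ↦ div_nonneg (mul_nonneg ha (hB k).le) (hB i).le)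
        (fun i ↦ (sqDistRatio_pos hP hB k i).le) hload k

lemma div_sum_sqDistRatio (hP : ∀ i, 0 < P i) (hB : ∀ i, 0 < B i) (c : Fin K → ℝ) (k : Fin K) :
    lam k / ∑ i, lam i * sqDistRatio P B k i * c i =
      lam k * √(B k * P k) / ∑ i, lam i * √(B i * P i) * c i := by
  have hk : 0 < √(B k * P k) := Real.sqrt_pos.2 (mul_pos (hB k) (hP k))
  rw [← mul_div_mul_right _ _ hk.ne', Finset.sum_mul]
  congr 1
  refine Finset.sum_congr rfl fun i _ ↦ ?_
  rw [sqDistRatio_eq_div hP hB]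
  field_simp

lemma IsNetwork.assocProb_eq (hnet : IsNetwork μ lam X h) (hlam : ∀ i, 0 < lam i)
    (hP : ∀ i, 0 < P i) (hB : ∀ i, 0 < B i) (k : Fin K) :
    assocProb μ P B X k = lam k * √(B k * P k) / ∑ i, lam i * √(B i * P i) := by
  have hint := hnet.setLIntegral_expInterference hlam hP hB le_rfl k
  simp only [expInterference, zero_mul, zero_div, ENNReal.ofReal_zero, tsum_zero, negExp_zero,
    setLIntegral_one] at hint
  rw [assocProb, measureReal_def, hint, div_sum_sqDistRatio hP hB, ENNReal.toReal_ofReal]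
  · simp only [loadFactor_zero, mul_one]
  · exact div_nonneg (mul_nonneg (hlam k).le (Real.sqrt_nonneg _)) (Finset.sum_nonneg fun i _ ↦
      mul_nonneg (mul_nonneg (hlam i).le (Real.sqrt_nonneg _)) (loadFactor_pos _).le)

lemma IsNetwork.tierLT_eq_inv_assocProb_mul (hnet : IsNetwork μ lam X h)
    (hlam : ∀ i, 0 ≤ lam i) (hP : ∀ i, 0 ≤ P i) (ha : 0 ≤ a) (k : Fin K) :
    tierLT μ P B X h a k = (assocProb μ P B X k)⁻¹ *
      (∫⁻ ω in assocEvent P B X k, expInterference P X h a k ω ∂μ).toReal := by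
  rw [tierLT, ProbabilityTheory.cond, integral_smul_measure, ENNReal.toReal_inv, assocProb,
    measureReal_def, smul_eq_mul]
  congr 1
  rw [← integral_toReal (measurable_expInterference hnet.measurable_location
    hnet.fading_measurable a k).aemeasurable
    (ae_of_all _ fun ω ↦ (negExp_le_one _).trans_lt ENNReal.one_lt_top)]
  refine integral_congr_ae ?_
  filter_upwards [ae_restrict_of_ae (hnet.ae_summable_interferenceTerm hlam hP k)] with ω hω
  exact (toReal_expInterference hP ha hω).symm

lemma IsNetwork.tierLT_eq (hnet : IsNetwork μ lam X h) (hlam : ∀ i, 0 < lam i)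
    (hP : ∀ i, 0 < P i) (hB : ∀ i, 0 < B i) (ha : 0 ≤ a) (k : Fin K) :
    tierLT μ P B X h a k = (∑ i, lam i * √(B i * P i)) /
      ∑ i, lam i * √(B i * P i) * loadFactor (a * B k / B i) := by
  have hw : ∀ i, 0 < lam i * √(B i * P i) := fun i ↦
    mul_pos (hlam i) (Real.sqrt_pos.2 (mul_pos (hB i) (hP i)))
  rw [hnet.tierLT_eq_inv_assocProb_mul (fun i ↦ (hlam i).le) (fun i ↦ (hP i).le) ha,
    hnet.setLIntegral_expInterference hlam hP hB ha, hnet.assocProb_eq hlam hP hB,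
    div_sum_sqDistRatio hP hB, ENNReal.toReal_ofReal, inv_div, div_mul_div_cancel₀ (hw k).ne']
  exact div_nonneg (hw k).le
    (Finset.sum_nonneg fun i _ ↦ mul_nonneg (hw i).le (loadFactor_pos _).le)

lemma IsNetwork.averagedLT_eq (hnet : IsNetwork μ lam X h) (hlam : ∀ i, 0 < lam i)
    (hP : ∀ i, 0 < P i) (hB : ∀ i, 0 < B i) (ha : 0 ≤ a) :
    averagedLT μ P B X h a = ∑ k, lam k * √(B k * P k) /
      ∑ i, lam i * √(B i * P i) * loadFactor (a * B k / B i) := by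
  refine Finset.sum_congr rfl fun k _ ↦ ?_
  have hsum : 0 < ∑ i, lam i * √(B i * P i) := Finset.sum_pos
    (fun i _ ↦ mul_pos (hlam i) (Real.sqrt_pos.2 (mul_pos (hB i) (hP i)))) ⟨k, Finset.mem_univ k⟩
  rw [hnet.assocProb_eq hlam hP hB, hnet.tierLT_eq hlam hP hB ha, div_mul_div_cancel₀ hsum.ne']

lemma IsNetwork.averagedLT_eq_sum_inv (hnet : IsNetwork μ lam X h) (hlam : ∀ i, 0 < lam i)
    (hP : ∀ i, 0 < P i) (hB : ∀ i, 0 < B i) (ha : 0 ≤ a) :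
    averagedLT μ P B X h a = ∑ k, (∑ i, lam i / lam k * √(B i * P i / (B k * P k)) *
      loadFactor (a * B k / B i))⁻¹ := by
  rw [hnet.averagedLT_eq hlam hP hB ha]
  refine Finset.sum_congr rfl fun k _ ↦ ?_
  rw [← inv_div, Finset.sum_div]
  congr 1
  refine Finset.sum_congr rfl fun i _ ↦ ?_
  rw [Real.sqrt_div (mul_pos (hB i) (hP i)).le]
  ring

lemma IsNetwork.averagedLT_eq_of_forall_bias_eq [NeZero K] (hnet : IsNetwork μ lam X h)
    (hlam : ∀ i, 0 < lam i) (hP : ∀ i, 0 < P i) (hB : ∀ i, 0 < B i) (ha : 0 ≤ a)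
    (hBB : ∀ i j, B i = B j) : averagedLT μ P B X h a = 1 / loadFactor a := by
  have hsum : 0 < ∑ i, lam i * √(B i * P i) := Finset.sum_pos
    (fun i _ ↦ mul_pos (hlam i) (Real.sqrt_pos.2 (mul_pos (hB i) (hP i)))) Finset.univ_nonempty
  have hratio : ∀ k i, a * B k / B i = a := fun k i ↦ by
    rw [hBB k i, mul_div_cancel_right₀ _ (hB i).ne']
  simp_rw [hnet.averagedLT_eq hlam hP hB ha, hratio]
  rw [← Finset.sum_mul, ← Finset.sum_div, ← div_div, div_self hsum.ne']

end LaplaceTransform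

end MultiTier

theorem mainTheorem7 {Ω : Type*} [MeasurableSpace Ω] (μ : Measure Ω) [IsProbabilityMeasure μ]
    {K : ℕ} (hK : 1 ≤ K) (lam P B : Fin K → ℝ)
    (hlam : ∀ i, 0 < lam i) (hP : ∀ i, 0 < P i) (hB : ∀ i, 0 < B i)
    (X : Fin K → ℕ → Ω → MultiTier.Plane) (h : Fin K → ℕ → Ω → ℂ)
    (hnet : MultiTier.IsNetwork μ lam X h) (a : ℝ) (ha : 0 ≤ a) :
    (∀ k, ∀ᵐ ω ∂μ, Summable (MultiTier.interferenceTerm P X h k ω)) ∧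
    (∀ k, MultiTier.assocProb μ P B X k =
      lam k * √(B k * P k) / ∑ i, lam i * √(B i * P i)) ∧
    (∀ k, MultiTier.tierLT μ P B X h a k =
      (∑ i, √(B i * P i) * lam i) /
        ∑ l, √(B l * P l) * lam l *
          (1 + √(a * B k / B l) * Real.arctan √(a * B k / B l))) ∧
    MultiTier.averagedLT μ P B X h a =
      ∑ k, (∑ i, lam i / lam k * √(B i * P i / (B k * P k)) *
          (1 + √(a * B k / B i) * Real.arctan √(a * B k / B i)))⁻¹ ∧
    ((∀ i j, B i = B j) →
      MultiTier.averagedLT μ P B X h a = 1 / (1 + √a * Real.arctan √a)) := by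
  have : NeZero K := ⟨by omega⟩
  refine ⟨hnet.ae_summable_interferenceTerm (fun i ↦ (hlam i).le) fun i ↦ (hP i).le,
    hnet.assocProb_eq hlam hP hB, fun k ↦ ?_, hnet.averagedLT_eq_sum_inv hlam hP hB ha,
    hnet.averagedLT_eq_of_forall_bias_eq hlam hP hB ha⟩
  simp_rw [mul_comm √(B _ * P _) (lam _)]
  exact hnet.tierLT_eq hlam hP hB ha k
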